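/- Let $E$ be a finite set. *Trees.* Let $J_E$ be the set of isomorphism classes of bipartite trees labelled by $E$ and planted at a root $\star$: finite trees whose vertices are the root $\star$, one labelled vertex $S_e$ for each $e\in E$, and unlabelled ("mute") vertices, such that every edge joins a mute vertex to a labelled vertex or to the root, no mute vertex is a leaf, and the root has exactly one neighbour (isomorphisms preserve the root and the labels). A fold of such a tree identifies two distinct mute neighbours of one labelled vertex; $J_E$ is ordered by $A\le A'$ if $A$ is obtained from $A'$ by a finite sequence of folds, and this ordered set is regarded as a category. Let $\mathcal F_E\subset J_E$ be the set of trees all of whose mute vertices, except possibly the neighbour of the root, have exactly two neighbours. *The functor $F_E$.* Let $\Gamma$ be the category of finite sets and partial functions. For $A\in J_E$ and $e\in E$ let $\mathcal P_e^A$ be the set of connected components of $A-S_e$ other than that of the root. Components are viewed as sets of labelled vertices (together with the root); for $A\le A'$ the partition given by $A'-S_e$ refines that given by $A-S_e$, and $f_e^{A,A'}:\mathcal P_e^{A'}\to\mathcal P_e^{A}$ is the partial function sending a part to the part of $\mathcal P_e^A$ that contains it, undefined on the parts contained in the component of the root of $A-S_e$. Then $F_E:J_E\to(\Gamma^E)^{op}$,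 $A\mapsto(\mathcal P_e^A)_{e\in E}$, $(A\le A')\mapsto(f_e^{A,A'})_{e\in E}$, is a functor. *Cross effects.* For an object $Y=(Y_e)_{e\in E}$ of $\Gamma^E$ and a family $U=(U_e)_{e\in E}$ of subsets $U_e\subseteq Y_e$, let $d_{Y,U}:Y\to Y$ be the endomorphism whose component at $e$ is the partial identity of $Y_e$ with domain $U_e$. For a functor $T:(\Gamma^E)^{op}\to\mathbf{Ab}$ put $$cr_Y(T)=\bigcap_{U\subsetneq Y}\ker\bigl(T(d_{Y,U}):T(Y)\to T(Y)\bigr),$$ the intersection being over the families $U$ with $U_e\neq Y_e$ for at least one $e$; this is a functor of $T$. *Homology.* For a small category $J$, $H_n(J;-)=\mathrm{Tor}_n^J(\mathbf Z,-)$ is the $n$-th left derived functor of $\mathrm{colim}$ on the category of functors $J\to\mathbf{Ab}$. **Proposition.** There is an isomorphism, natural in the functor $T:(\Gamma^E)^{op}\to\mathbf{Ab}$, $$H_0(J_E;T\circ F_E)\;\simeq\;\bigoplus_{A\in\mathcal F_E}cr_{F_E(A)}(T),$$ and $H_n(J_E;T\circ F_E)=0$ for every $T$ and every $n>0$. -/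

import Mathlib

open CategoryTheory CategoryTheory.Limits Opposite

universe u

/-! ## Planted bipartite trees labelled by a finite set -/

/-- The incidence graph of a family of subsets of `Option E`: its vertices are the elements of
`Option E` (the root `none` and the labelled vertices `some e`) and the members of the family
(the mute vertices); the only edges join an element `x` to the members `m` that contain `x`. -/
def incidenceGraph {E : Type u} (mutes : Set (Set (Option E))) :
    SimpleGraph (Option E ⊕ ↥mutes) where
  Adj v w := match v, w with
    | Sum.inl x, Sum.inr m => x ∈ m.1
    | Sum.inr m, Sum.inl x => x ∈ m.1
    | _, _ => False
  symm := ⟨by rintro (x | m) (y | n) h <;> exact h⟩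
  loopless := ⟨by rintro (x | m) h <;> exact h⟩

/-- The set `J_E` of (isomorphism classes of) bipartite trees labelled by `E` and planted at a
root. Vertices are the root, the labelled vertices (one for each element of `E`) and the mute
vertices. The neighbours of a labelled vertex, and those of the root, are mute; a mute vertex has
no mute neighbour and is never a leaf; the root has exactly one neighbour.

A mute vertex is recorded as the set of its neighbours. As it is not a leaf, and as two distinct
mute vertices of a tree have at most one common neighbour, different mute vertices are recorded
by different sets; so two such trees are equal exactly when there is an isomorphism between them
that fixes the root and the labels. -/
@[ext]
structure PlantedTree (E : Type u) : Type u where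
  /-- the mute vertices -/
  mutes : Set (Set (Option E))
  isTree : (incidenceGraph mutes).IsTree
  not_leaf : ∀ m ∈ mutes, m.Nontrivial
  root_unique : ∃! m, m ∈ mutes ∧ none ∈ m

namespace PlantedTree

variable {E : Type u}

/-- The underlying graph of a planted tree. -/
abbrev graph (A : PlantedTree E) : SimpleGraph (Option E ⊕ ↥A.mutes) :=
  incidenceGraph A.mutes

/-- `IsFold A' A`: the tree `A` is obtained from `A'` by folding together two edges that issue
from one labelled vertex `e`, that is by identifying two mute neighbours `m ≠ m'` of `e`. -/
def IsFold (A' A : PlantedTree E) : Prop :=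
  ∃ (e : E) (m m' : Set (Option E)), m ∈ A'.mutes ∧ m' ∈ A'.mutes ∧ m ≠ m' ∧
    some e ∈ m ∧ some e ∈ m' ∧ A.mutes = insert (m ∪ m') (A'.mutes \ {m, m'})

theorem IsFold.ncard_lt [Finite E] {A' A : PlantedTree E} (h : IsFold A' A) :
    A.mutes.ncard < A'.mutes.ncard := by
  obtain ⟨e, m, m', hm, hm', hne, -, -, h⟩ := h
  have h1 : (A'.mutes \ {m, m'}).ncard + 2 = A'.mutes.ncard := by
    rw [← Set.ncard_pair hne]
    exact Set.ncard_sdiff_add_ncard_of_subset (by rintro x (rfl | rfl) <;> assumption)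
  have h2 := Set.ncard_insert_le (m ∪ m') (A'.mutes \ {m, m'})
  rw [h]
  omega

/-- The folding order: `A ≤ A'` if `A` is obtained from `A'` by a finite sequence of folds. -/
instance [Finite E] : PartialOrder (PlantedTree E) where
  le A A' := Relation.ReflTransGen IsFold A' A
  le_refl _ := Relation.ReflTransGen.refl
  le_trans _ _ _ h h' := h'.trans h
  le_antisymm A B h h' := by
    have key : ∀ {C D : PlantedTree E}, Relation.ReflTransGen IsFold C D →
        D.mutes.ncard ≤ C.mutes.ncard := fun h => by
      induction h with
      | refl => exact le_rfl
      | tail _ hf ih => exact hf.ncard_lt.le.trans ih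
    rcases Relation.ReflTransGen.cases_head h with h0 | ⟨C, hC, hCA⟩
    · exact h0.symm
    · have := key hCA
      have := key h'
      have := hC.ncard_lt
      omega

theorem le_iff [Finite E] {A A' : PlantedTree E} :
    A ≤ A' ↔ Relation.ReflTransGen IsFold A' A := Iff.rfl

/-- The graph `A - S_e` obtained from `A` by removing the vertex labelled by `e`. -/
abbrev remove (A : PlantedTree E) (e : E) :
    SimpleGraph ↥{v : Option E ⊕ ↥A.mutes | v ≠ Sum.inl (some e)} :=
  A.graph.induce {v | v ≠ Sum.inl (some e)}

/-- An element of `Option E` other than `some e`, as a vertex of `A - S_e`. -/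
def vertex (A : PlantedTree E) (e : E) (x : {x : Option E // x ≠ some e}) :
    ↥{v : Option E ⊕ ↥A.mutes | v ≠ Sum.inl (some e)} :=
  ⟨Sum.inl x.1, fun h => x.2 (Sum.inl.inj h)⟩

/-- The partition into connected components of `A - S_e`, as a partition of the set formed by the
root and the labelled vertices other than `S_e` (every component contains such a vertex). -/
def branchSetoid (A : PlantedTree E) (e : E) : Setoid {x : Option E // x ≠ some e} where
  r x y := (A.remove e).Reachable (A.vertex e x) (A.vertex e y)
  iseqv := ⟨fun _ => SimpleGraph.Reachable.refl _, fun h => h.symm, fun h h' => h.trans h'⟩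

/-- The class of the root in the partition `A.branchSetoid e`. -/
def rootBranch (A : PlantedTree E) (e : E) : Quotient (A.branchSetoid e) :=
  Quotient.mk _ ⟨none, by simp⟩

/-- `𝒫_e^A`: the set of connected components of `A - S_e` other than that of the root. -/
def Branch (A : PlantedTree E) (e : E) : Type u :=
  {c : Quotient (A.branchSetoid e) // c ≠ A.rootBranch e}

instance [Finite E] (A : PlantedTree E) (e : E) : Finite (A.Branch e) := by
  unfold Branch
  infer_instance

theorem exists_subset_of_isFold {A' A : PlantedTree E} (h : IsFold A' A) {m : Set (Option E)}
    (hm : m ∈ A'.mutes) : ∃ n ∈ A.mutes, m ⊆ n := by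
  obtain ⟨e, m₁, m₂, -, -, -, -, -, h⟩ := h
  by_cases h1 : m = m₁ ∨ m = m₂
  · refine ⟨m₁ ∪ m₂, by simp [h], ?_⟩
    rcases h1 with rfl | rfl
    · exact Set.subset_union_left
    · exact Set.subset_union_right
  · refine ⟨m, ?_, subset_rfl⟩
    rw [h]
    exact Set.mem_insert_of_mem _ ⟨hm, by simpa using h1⟩

theorem exists_subset_of_le [Finite E] {A A' : PlantedTree E} (h : A ≤ A') {m : Set (Option E)}
    (hm : m ∈ A'.mutes) : ∃ n ∈ A.mutes, m ⊆ n := by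
  rw [le_iff] at h
  induction h with
  | refl => exact ⟨m, hm, subset_rfl⟩
  | tail _ hf ih =>
    obtain ⟨n, hn, hmn⟩ := ih
    obtain ⟨n', hn', hnn'⟩ := exists_subset_of_isFold hf hn
    exact ⟨n', hn', hmn.trans hnn'⟩

/-- If `A ≤ A'`, the partition of `A' - S_e` refines that of `A - S_e`. -/
theorem branchSetoid_le [Finite E] {A A' : PlantedTree E} (h : A ≤ A') (e : E) :
    A'.branchSetoid e ≤ A.branchSetoid e := by
  choose f hf hsub using fun m : ↥A'.mutes => exists_subset_of_le h m.2
  let g : A'.remove e →g A.remove e :=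
    { toFun := fun v => match v with
        | ⟨Sum.inl x, hx⟩ => ⟨Sum.inl x, fun h' => hx (by
            rw [Sum.inl.inj h'])⟩
        | ⟨Sum.inr m, _⟩ => ⟨Sum.inr ⟨f m, hf m⟩, by simp⟩
      map_rel' := by
        rintro ⟨x | m, hx⟩ ⟨y | n, hy⟩ hadj
        · exact hadj
        · exact hsub n hadj
        · exact hsub m hadj
        · exact hadj }
  intro x y hxy
  exact SimpleGraph.Reachable.map g hxy

/-- For `A ≤ A'`, the class of `A - S_e` that contains a given class of `A' - S_e`. -/
def coarsen [Finite E] {A A' : PlantedTree E} (h : A ≤ A') (e : E) :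
    Quotient (A'.branchSetoid e) → Quotient (A.branchSetoid e) :=
  Quotient.map id fun _ _ hxy => branchSetoid_le h e hxy

theorem coarsen_refl [Finite E] (A : PlantedTree E) (e : E) (c : Quotient (A.branchSetoid e)) :
    coarsen (le_refl A) e c = c := by
  induction c using Quotient.inductionOn
  rfl

theorem coarsen_coarsen [Finite E] {A A' A'' : PlantedTree E} (h : A ≤ A') (h' : A' ≤ A'') (e : E)
    (c : Quotient (A''.branchSetoid e)) :
    coarsen h e (coarsen h' e c) = coarsen (h.trans h') e c := by
  induction c using Quotient.inductionOn
  rfl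

theorem coarsen_rootBranch [Finite E] {A A' : PlantedTree E} (h : A ≤ A') (e : E) :
    coarsen h e (A'.rootBranch e) = A.rootBranch e := rfl

/-- For `A ≤ A'`, the partial function `f_e^{A,A'}` from `𝒫_e^{A'}` to `𝒫_e^A` which sends a part to
the part of `𝒫_e^A` that contains it; it is not defined on the parts that are contained in the
component of the root of `A - S_e`. -/
def branchMap [Finite E] {A A' : PlantedTree E} (h : A ≤ A') (e : E) :
    A'.Branch e →. A.Branch e :=
  fun c => ⟨coarsen h e c.1 ≠ A.rootBranch e, fun hc => ⟨coarsen h e c.1, hc⟩⟩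

theorem branchMap_refl [Finite E] (A : PlantedTree E) (e : E) :
    branchMap (le_refl A) e = PFun.id (A.Branch e) := by
  refine PFun.ext fun c d => ?_
  constructor
  · rintro ⟨hc, rfl⟩
    exact (Part.mem_some_iff.2 (Subtype.ext (coarsen_refl A e c.1)))
  · intro hd
    obtain rfl : d = c := Part.mem_some_iff.1 hd
    exact ⟨fun h0 => d.2 ((coarsen_refl A e d.1).symm.trans h0), Subtype.ext (coarsen_refl A e d.1)⟩

theorem branchMap_comp [Finite E] {A A' A'' : PlantedTree E} (h : A ≤ A') (h' : A' ≤ A'') (e : E) :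
    (branchMap h e).comp (branchMap h' e) = branchMap (h.trans h') e := by
  refine PFun.ext fun c d => ?_
  refine Iff.trans Part.mem_bind_iff ?_
  constructor
  · rintro ⟨_, ⟨hc, rfl⟩, ⟨hc', rfl⟩⟩
    exact ⟨fun h0 => hc' ((coarsen_coarsen h h' e c.1).trans h0), Subtype.ext (coarsen_coarsen h h' e c.1).symm⟩
  · rintro ⟨hc, rfl⟩
    have hc0 : coarsen (h.trans h') e c.1 ≠ A.rootBranch e := hc
    rw [← coarsen_coarsen h h'] at hc0
    exact ⟨⟨coarsen h' e c.1, fun h0 => hc0 (by rw [h0, coarsen_rootBranch])⟩, ⟨_, rfl⟩,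
      ⟨hc0, Subtype.ext (coarsen_coarsen h h' e c.1)⟩⟩

/-- The set `𝓕_E` of the trees of `J_E` all of whose mute vertices, except possibly the neighbour
of the root, are bivalent. -/
def bivalentTrees (E : Type u) : Set (PlantedTree E) :=
  {A | ∀ m ∈ A.mutes, none ∉ m → m.ncard = 2}

end PlantedTree

/-! ## The category of finite sets and partial functions -/

/-- The objects of the category `Γ`: finite sets. -/
structure FinPartialFun : Type (u + 1) where
  /-- the underlying set -/
  carrier : Type u
  [finite : Finite carrier]

namespace FinPartialFun

attribute [instance] FinPartialFun.finite

/-- The morphisms of the category `Γ`: partial functions. -/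
@[ext]
structure Hom (X Y : FinPartialFun.{u}) : Type u where
  /-- the underlying partial function -/
  toPFun : X.carrier →. Y.carrier

/-- The category `Γ` of finite sets and partial functions. -/
instance : LargeCategory FinPartialFun.{u} where
  Hom := Hom
  id X := ⟨PFun.id X.carrier⟩
  comp f g := ⟨g.toPFun.comp f.toPFun⟩
  id_comp f := Hom.ext (PFun.comp_id f.toPFun)
  comp_id f := Hom.ext (PFun.id_comp f.toPFun)
  assoc f g h := Hom.ext (PFun.comp_assoc h.toPFun g.toPFun f.toPFun).symm

/-- A finite set as an object of `Γ`. -/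
abbrev of (X : Type u) [Finite X] : FinPartialFun.{u} := ⟨X⟩

/-- A partial function as a morphism of `Γ`. -/
abbrev ofPFun {X Y : FinPartialFun.{u}} (f : X.carrier →. Y.carrier) : X ⟶ Y := Hom.mk f

/-- The idempotent endomorphism `d_{X,M}` of an object `X` of `Γ`: the identity of `M ⊆ X`, seen
as a partial function from `X` to `X` with domain `M`. -/
def idem (X : FinPartialFun.{u}) (M : Set X.carrier) : X ⟶ X :=
  ofPFun ((PFun.id X.carrier).restrict (p := M) fun _ _ => trivial)

end FinPartialFun

/-! ## The functor `F_E` -/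

/-- The functor `F_E : J_E → (Γ^E)ᵒᵖ` with `F_E(A) = (𝒫_e^A)_e` and
`F_E(A ≤ A') = (f_e^{A,A'})_e`. -/
def branchFunctor (E : Type u) [Finite E] : PlantedTree E ⥤ (E → FinPartialFun.{u})ᵒᵖ where
  obj A := op fun e => FinPartialFun.of (A.Branch e)
  map {_ _} h := Quiver.Hom.op fun e =>
    FinPartialFun.ofPFun (PlantedTree.branchMap (leOfHom h) e)
  map_id A := by
    refine Quiver.Hom.unop_inj (funext fun e => ?_)
    apply FinPartialFun.Hom.ext
    exact PlantedTree.branchMap_refl A e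
  map_comp {A A' A''} h h' := by
    refine Quiver.Hom.unop_inj (funext fun e => ?_)
    apply FinPartialFun.Hom.ext
    exact (PlantedTree.branchMap_comp (leOfHom h) (leOfHom h') e).symm

/-! ## Cross effects -/

section CrossEffects

variable {E : Type u}

/-- The idempotent `d_{Y,M} = (d_{Y_e,M_e})_e` of `Γ^E` attached to a family of subsets
`M_e ⊆ Y_e`. -/
def familyIdem (Y : E → FinPartialFun.{u}) (M : ∀ e, Set (Y e).carrier) : Y ⟶ Y :=
  fun e => FinPartialFun.idem (Y e) (M e)

/-- `cr_M(T)(Y) = (⋂_{U ⊊ M} ker T(d_{Y,U})) ∩ im T(d_{Y,M})`, a subgroup of `T(Y)`. Here `U` and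
`M` are families of subsets of the `Y_e`, and `U ⊊ M` means that `U_e ⊆ M_e` for all `e` and
`U ≠ M`. -/
def crossEffectAt (Y : E → FinPartialFun.{u}) (M : ∀ e, Set (Y e).carrier)
    (T : (E → FinPartialFun.{u})ᵒᵖ ⥤ Ab.{u}) : AddSubgroup (T.obj (op Y)) :=
  (⨅ U : {U : ∀ e, Set (Y e).carrier // U < M}, (T.map (familyIdem Y U.1).op).hom.ker) ⊓
    (T.map (familyIdem Y M).op).hom.range

theorem crossEffectAt_le_comap (Y : E → FinPartialFun.{u}) (M : ∀ e, Set (Y e).carrier)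
    {T T' : (E → FinPartialFun.{u})ᵒᵖ ⥤ Ab.{u}} (η : T ⟶ T') :
    crossEffectAt Y M T ≤ (crossEffectAt Y M T').comap (η.app (op Y)).hom := by
  have nat : ∀ (N : ∀ e, Set (Y e).carrier) (x : T.obj (op Y)),
      (T'.map (familyIdem Y N).op).hom ((η.app (op Y)).hom x) =
        (η.app (op Y)).hom ((T.map (familyIdem Y N).op).hom x) := fun N x =>
    (ConcreteCategory.congr_hom (η.naturality (familyIdem Y N).op) x).symm
  rintro x ⟨hx, y, rfl⟩
  refine ⟨?_, (η.app (op Y)).hom y, nat M y⟩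
  refine AddSubgroup.mem_iInf.2 fun U => ?_
  exact (nat U.1 _).trans
    ((congrArg _ (AddSubgroup.mem_iInf.1 hx U)).trans (map_zero (η.app (op Y)).hom))

/-- The cross effect `cr_Y(T) = cr_M(T)(Y)` with `M = (Y_e)_e` the whole of `Y`, as a functor of
`T : (Γ^E)ᵒᵖ ⥤ Ab`. -/
def crossEffect (Y : E → FinPartialFun.{u}) :
    ((E → FinPartialFun.{u})ᵒᵖ ⥤ Ab.{u}) ⥤ Ab.{u} where
  obj T := AddCommGrpCat.of ↥(crossEffectAt Y ⊤ T)
  map {T T'} η := AddCommGrpCat.ofHom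
    (((η.app (op Y)).hom.comp (crossEffectAt Y ⊤ T).subtype).codRestrict (crossEffectAt Y ⊤ T')
      fun x => crossEffectAt_le_comap Y ⊤ η x.2)
  map_id T := by
    ext x
    rfl
  map_comp η θ := by
    ext x
    rfl

end CrossEffects

/-! ## Homology of a small category with coefficients in a functor -/

section Homology

instance ab_enoughProjectives : EnoughProjectives Ab.{u} :=
  (Equivalence.enoughProjectives_iff
    (forget₂ (ModuleCat.{u} ℤ) Ab.{u}).asEquivalence).1 inferInstance

instance functorAb_enoughProjectives (J : Type u) [SmallCategory J] :
    EnoughProjectives (J ⥤ Ab.{u}) where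
  presentation F := by
    let p : J → (J ⥤ Ab.{u}) := fun a =>
      (evaluationLeftAdjoint Ab.{u} a).obj (Projective.over (F.obj a))
    let q : ∀ a, p a ⟶ F := fun a =>
      ((evaluationAdjunctionRight Ab.{u} a).homEquiv _ _).symm (Projective.π (F.obj a))
    have hp : ∀ a, Projective (p a) := fun a =>
      (evaluationAdjunctionRight Ab.{u} a).map_projective _ inferInstance
    have hq : ∀ a, Epi ((q a).app a) := fun a => by
      have h : (evaluationAdjunctionRight Ab.{u} a).homEquiv _ _ (q a) = Projective.π (F.obj a) :=
        Equiv.apply_symm_apply _ _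
      rw [Adjunction.homEquiv_unit] at h
      have : Epi ((evaluationAdjunctionRight Ab.{u} a).unit.app (Projective.over (F.obj a)) ≫
          (q a).app a) := by
        rw [show _ ≫ (q a).app a = Projective.π (F.obj a) from h]
        infer_instance
      exact epi_of_epi ((evaluationAdjunctionRight Ab.{u} a).unit.app _) _
    refine ⟨{ p := ∐ p, f := Sigma.desc q, epi := ?_ }⟩
    rw [NatTrans.epi_iff_epi_app]
    intro a
    have : Epi ((Sigma.ι p a).app a ≫ (Sigma.desc q).app a) := by
      rw [← NatTrans.comp_app, Sigma.ι_desc]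
      exact hq a
    exact epi_of_epi ((Sigma.ι p a).app a) _

/-- The homology `H_n(J; -) = Tor_n^J(ℤ, -)` of a small category `J` with coefficients in functors
`J ⥤ Ab`: the `n`-th left derived functor of `colim = ℤ ⊗_J - : (J ⥤ Ab) ⥤ Ab`. -/
noncomputable def categoryHomology (J : Type u) [SmallCategory J] (n : ℕ) :
    (J ⥤ Ab.{u}) ⥤ Ab.{u} :=
  (colim : (J ⥤ Ab.{u}) ⥤ Ab.{u}).leftDerived n

end Homology

/-!
The homology of `J = J_E` with coefficients in `T ∘ F_E` is governed by two facts about trees, both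
of which are read off from an encoding of the planted trees by families of partial equivalence
relations.

*Nestings.* A planted tree `A` is recorded by the relations `rel e v w`: the labels `v` and `w` lie
in the same component of `A - S_e`, which is not the component of the root. This is a `Nesting`,
every nesting on a nonempty set of labels comes from a planted tree (`Nesting.toTree`), and the
folding order has a simple description in these terms (`PlantedTree.le_iff_nesting`), because the
folding order is the order by refinement of the partitions of the `A - S_e`
(`PlantedTree.le_iff_branchSetoid_le`). Folding branches away and unfolding all the mute vertices
below the labelled vertices become `Nesting.restrict` and `Nesting.split`. The branches of `A` are a
retract of the constant family `labels E` with value `E`, by maps `A.ofBranches` and `A.toBranches`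
of which the second is compatible with the order. So there is a map `colimToLabels` from `colim (T ∘
F_E)` to `T (labels E)`.

*Degree `0`.* The cross effects `cr_{F_E(B)}(T)`, for `B` in `bivalentTrees E`, map to the colimit.
These maps generate the colimit: a class of `T(F_E(A))` comes from the unfolding of `A`, and modulo
the cross effect it is a sum of elements in the images of the `T(d_U)`; each `d_U` factors through
the tree obtained by folding the branches outside `U`, which has fewer pairs (ancestor, descendant)
(`eq_zero_of_crossEffectι_comp_eq_zero`). The maps are jointly injective: composing `colimToLabels`
with `T(B.ofBranches)` and with the projection onto the cross effect gives a left inverse, since for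
two different bivalent trees the comparison of the branches is not both everywhere defined and
surjective (`crossEffectι_ofBranches_toBranches_of_ne`). As this left inverse factors through
`colimToLabels`, the latter is injective. Hence `T ↦ colim (T ∘ F_E)` preserves monomorphisms
(`mono_colim_map_whiskerLeft`), which makes dimension shifting possible.

*Positive degrees.* Say that a functor `X` on `J` is acyclic if `Ext^n(X, const I) = 0` for all `n >
0` and all injective `I`; then its higher homology vanishes (`isZero_leftDerived_of_extAcyclic`).
Over `J`, any `T ∘ F_E` is a quotient of some `P ∘ F_E`, where `P` is a direct sum of representable
functors tensored with a group, with a kernel of the same form. By dimension shifting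
(`extAcyclic_of_family`), it suffices to see that `P ∘ F_E` is acyclic. As `F_E(A)` is a retract of
`labels E`, the functor `P ∘ F_E` splits into finitely many constant functors, each of them
supported on the set of the trees `A` such that a given `g : labels E ⟶ Y` factors through
`A.toBranches` (`coeffAt`, `singleAt`). This set is conically contractible: folding the branches on
which `g` is not defined gives `A ≥ foldAt g A`, and all the trees `foldAt g A` lie below a common
one. A constant functor on such a set is acyclic (`ConicalContraction.Adapted.extAcyclic`), by
dimension shifting again.
-/

/-! ### Acyclic objects and dimension shifting -/

section DimensionShifting

open Abelian

universe w v₁ v₂ u₁ u₂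

variable {C : Type u₁} [Category.{v₁} C] [Abelian C] [HasExt.{w} C]
  {D : Type u₂} [Category.{v₂} D]

/-- For an adjunction `L ⊣ R`, the objects `X` such that all the groups `Ext^n(X, R I)` with `n > 0`
and `I` injective vanish. When there are enough injective objects, `L` has no higher left derived
functor on such an object. -/
def ExtAcyclic (R : D ⥤ C) (X : C) : Prop :=
  ∀ (n : ℕ) (I : D) [Injective I] (x : Ext.{w} X (R.obj I) (n + 1)), x = 0

/-- Let `P` be a projective resolution of `X`. The map from `L P_{n+1}` to an injective hull of the
cokernel of `L P_{n+2} → L P_{n+1}` corresponds to a cocycle of `Hom(P, R I)`. As it is a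
coboundary, the map factors through `L P_{n+1} → L P_n`, which gives the exactness of `L P` at `L
P_{n+1}`. -/
theorem isZero_leftDerived_of_extAcyclic [EnoughProjectives C] [Abelian D] [EnoughInjectives D]
    {L : C ⥤ D}
    [L.Additive] {R : D ⥤ C} (adj : L ⊣ R) {X : C} (hX : ExtAcyclic.{w} R X) (n : ℕ) :
    IsZero ((L.leftDerived (n + 1)).obj X) := by
  let P := projectiveResolution X
  refine IsZero.of_iso ?_ (P.isoLeftDerivedObj L (n + 1))
  erw [← HomologicalComplex.exactAt_iff_isZero_homology]
  rw [HomologicalComplex.exactAt_iff' _ (n + 2) (n + 1) n (by simp) (by simp),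
    ShortComplex.exact_iff_kernel_ι_comp_cokernel_π_zero]
  rw [← cancel_mono (Injective.ι _), zero_comp, Category.assoc]
  -- A cocycle with values in an injective hull of the cokernel is a coboundary.
  let φ : L.obj (P.complex.X (n + 1)) ⟶ _ :=
    cokernel.π (L.map (P.complex.d (n + 2) (n + 1))) ≫ Injective.ι _
  have hφ : L.map (P.complex.d (n + 2) (n + 1)) ≫ φ = 0 := by simp [φ]
  have h : P.complex.d (n + 2) (n + 1) ≫ adj.homEquiv _ _ φ = 0 := by
    have := adj.right_adjoint_additive
    rw [← adj.homEquiv_naturality_left, hφ, Adjunction.homEquiv_unit, Functor.map_zero, comp_zero]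
  obtain ⟨g, hg⟩ := (P.extMk_eq_zero_iff _ (n + 2) rfl h n rfl).1 (hX n _ _)
  have hg' : L.map (P.complex.d (n + 1) n) ≫ (adj.homEquiv _ _).symm g = φ := by
    rw [← adj.homEquiv_naturality_left_symm, hg, Equiv.symm_apply_apply]
  change kernel.ι (L.map (P.complex.d (n + 1) n)) ≫ φ = 0
  rw [← hg', kernel.condition_assoc, zero_comp]

theorem extAcyclic_of_projective (R : D ⥤ C) (X : C) [Projective X] : ExtAcyclic.{w} R X :=
  fun _ _ _ x => x.eq_zero_of_projective

/-- If the identity of `X` is a finite sum of morphisms each of which factors through an acyclic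
object, then `X` is acyclic. -/
theorem extAcyclic_of_sum_eq_id {R : D ⥤ C} {X : C} {ι : Type*} [Fintype ι] {M : ι → C}
    (α : ∀ i, X ⟶ M i) (β : ∀ i, M i ⟶ X) (h : ∑ i, α i ≫ β i = 𝟙 X)
    (hM : ∀ i, ExtAcyclic.{w} R (M i)) : ExtAcyclic.{w} R X := by
  intro n I _ x
  rw [← x.mk₀_id_comp, ← h, Ext.mk₀_sum, Ext.sum_comp]
  refine Finset.sum_eq_zero fun i _ => ?_
  rw [← Ext.mk₀_comp_mk₀_assoc, hM i n I ((Ext.mk₀ (β i)).comp x _), Ext.comp_zero]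

/-- Dimension shifting, simultaneously for a family of objects each of which is the quotient of an
acyclic object by a member of the family. -/
theorem extAcyclic_of_family {L : C ⥤ D} {R : D ⥤ C} (adj : L ⊣ R) {ι : Type*} (X : ι → C)
    (h : ∀ i, ∃ (j : ι) (P : C) (f : X j ⟶ P) (g : P ⟶ X i) (w : f ≫ g = 0),
      (ShortComplex.mk f g w).ShortExact ∧ ExtAcyclic.{w} R P ∧ Mono (L.map f)) (i : ι) :
    ExtAcyclic.{w} R (X i) := by
  intro n
  induction n generalizing i with
  | zero =>
    intro I _ x
    obtain ⟨j, P, f, g, w, hS, hP, hf⟩ := h i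
    obtain ⟨y, rfl⟩ := Ext.contravariant_sequence_exact₃ hS _ x (hP 0 I _) (n₀ := 0) rfl
    obtain ⟨φ, rfl⟩ := Ext.addEquiv₀.symm.surjective y
    have : L.map f ≫ Injective.factorThru ((adj.homEquiv _ _).symm φ) (L.map f) =
        (adj.homEquiv _ _).symm φ := Injective.comp_factorThru _ _
    have h2 : f ≫ adj.homEquiv _ _ (Injective.factorThru ((adj.homEquiv _ _).symm φ) (L.map f)) =
        φ := by
      rw [← adj.homEquiv_naturality_left, this, Equiv.apply_symm_apply]
    change hS.extClass.comp (Ext.mk₀ φ) _ = 0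
    rw [← h2, ← Ext.mk₀_comp_mk₀, ← Ext.comp_assoc_of_second_deg_zero]
    rw [hS.extClass_comp, Ext.zero_comp]
  | succ n ih =>
    intro I _ x
    obtain ⟨j, P, f, g, w, hS, hP, hf⟩ := h i
    obtain ⟨y, rfl⟩ := Ext.contravariant_sequence_exact₃ hS _ x (hP _ I _) (n₀ := n + 1) (by omega)
    rw [ih j I y, Ext.comp_zero]

end DimensionShifting

/-! ### Constant functors on conically contractible sets -/

section Contraction

open Abelian

instance functorAb_hasExt (J : Type u) [SmallCategory J] : HasExt.{u} (J ⥤ Ab.{u}) :=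
  hasExt_of_enoughProjectives.{u} _

variable {J : Type u} [PartialOrder J]

/-- A conical contraction of an upper set `S` of a poset to an element `b` of `S`, by a zigzag
`a ≥ r a ≤ b`, where `r` is a monotone idempotent map. -/
structure ConicalContraction (S : Set J) (r : J → J) (b : J) : Prop where
  isUpperSet : IsUpperSet S
  mem : ∀ {a}, a ∈ S → r a ∈ S
  le : ∀ {a}, a ∈ S → r a ≤ a
  mono : ∀ {a a'}, a ∈ S → a ≤ a' → r a ≤ r a'
  idem : ∀ {a}, a ∈ S → r (r a) = r a
  base_mem : b ∈ S
  le_base : ∀ {a}, a ∈ S → r a ≤ b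

namespace ConicalContraction

variable {S : Set J} {r : J → J} {b : J}

/-- The functors that vanish outside `S` and send the arrows `r a ≤ a`, for `a ∈ S`, to
isomorphisms. -/
structure Adapted (h : ConicalContraction S r b) (G : J ⥤ Ab.{u}) : Prop where
  isZero : ∀ a, a ∉ S → IsZero (G.obj a)
  isIso : ∀ a (ha : a ∈ S), IsIso (G.map (homOfLE (h.le ha)))

variable (h : ConicalContraction S r b) {G : J ⥤ Ab.{u}}
include h

open Classical in
/-- The colimit of an adapted functor is its value at the base point: the inverse of the map induced
by the zigzags `a ≥ r a ≤ b` is well defined because `r` is monotone. -/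
theorem Adapted.isIso_ι_base (hG : h.Adapted G) : IsIso (colimit.ι G b) := by
  let e : ∀ a, a ∈ S → (G.obj (r a) ≅ G.obj a) := fun a ha =>
    @asIso _ _ _ _ (G.map (homOfLE (h.le ha))) (hG.isIso a ha)
  have he : ∀ a ha, (e a ha).hom = G.map (homOfLE (h.le ha)) := fun _ _ => rfl
  let f : ∀ a, G.obj a ⟶ G.obj b := fun a =>
    if ha : a ∈ S then (e a ha).inv ≫ G.map (homOfLE (h.le_base ha)) else 0
  have hf : ∀ {a a' : J} (i : a ⟶ a'), G.map i ≫ f a' = f a := by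
    intro a a' i
    by_cases ha : a ∈ S
    · have ha' := h.isUpperSet (leOfHom i) ha
      simp only [f, dif_pos ha, dif_pos ha']
      rw [← cancel_epi (e a ha).hom, Iso.hom_inv_id_assoc, he, ← G.map_comp_assoc,
        Subsingleton.elim (homOfLE (h.le ha) ≫ i)
          (homOfLE (h.mono ha (leOfHom i)) ≫ homOfLE (h.le ha')), G.map_comp_assoc, ← he a' ha',
        Iso.hom_inv_id_assoc, ← G.map_comp]
      · rfl
      · exact ha
    · exact (hG.isZero a ha).eq_of_src _ _
  let c : Cocone G :=
    { pt := G.obj b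
      ι :=
        { app := f
          naturality := fun a a' i => (hf i).trans (Category.comp_id _).symm } }
  have hfb : f b = 𝟙 _ := by
    simp only [f, dif_pos h.base_mem]
    rw [Iso.inv_comp_eq, Category.comp_id]
    rfl
  refine ⟨colimit.desc G c, (colimit.ι_desc c b).trans hfb, ?_⟩
  refine colimit.hom_ext fun a => ?_
  rw [colimit.ι_desc_assoc, Category.comp_id]
  change f a ≫ colimit.ι G b = _
  by_cases ha : a ∈ S
  · simp only [f, dif_pos ha]
    rw [Category.assoc, Iso.inv_comp_eq, he a ha, colimit.w, colimit.w]
  · exact (hG.isZero a ha).eq_of_src _ _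

theorem mono_colim_map {K P : J ⥤ Ab.{u}} (hK : h.Adapted K) (hP : h.Adapted P)
    (f : K ⟶ P) [Mono f] : Mono ((colim : (J ⥤ Ab.{u}) ⥤ Ab.{u}).map f) := by
  have := Adapted.isIso_ι_base h hK
  have := Adapted.isIso_ι_base h hP
  have e : colim.map f = inv (colimit.ι K b) ≫ f.app b ≫ colimit.ι P b := by
    rw [eq_comm, IsIso.inv_comp_eq]
    exact (ι_colimMap f b).symm
  rw [e]
  infer_instance

/-- The representable functors attached to the elements of `S` fixed by `r` are adapted, because
`a ≤ a'` is equivalent to `a ≤ r a'` for such an element `a` of `S`. -/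
theorem adapted_evaluationLeftAdjoint {a : J} (ha : a ∈ S) (hra : r a = a) (M : Ab.{u}) :
    h.Adapted ((evaluationLeftAdjoint Ab.{u} a).obj M) where
  isZero a' ha' := by
    rw [IsZero.iff_id_eq_zero]
    exact Limits.Sigma.hom_ext _ _ fun i => absurd (h.isUpperSet (leOfHom i) ha) ha'
  isIso a' ha' := by
    refine ⟨Limits.Sigma.desc fun i => Limits.Sigma.ι (fun _ : a ⟶ r a' => M)
      (homOfLE (hra.ge.trans (h.mono ha (leOfHom i)))), ?_, ?_⟩
    · refine Limits.Sigma.hom_ext _ _ fun i => ?_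
      simp [evaluationLeftAdjoint]
      rfl
    · refine Limits.Sigma.hom_ext _ _ fun i => ?_
      simp [evaluationLeftAdjoint]
      rfl

theorem adapted_sigma {ι : Type u} (p : ι → (J ⥤ Ab.{u})) (hp : ∀ i, h.Adapted (p i)) :
    h.Adapted (∐ p) where
  isZero a ha := by
    refine IsZero.of_iso ?_ (PreservesCoproduct.iso ((evaluation J Ab.{u}).obj a) p)
    rw [IsZero.iff_id_eq_zero]
    exact Limits.Sigma.hom_ext _ _ fun i => ((hp i).isZero a ha).eq_of_src _ _
  isIso a ha := by
    have := fun i => (hp i).isIso a ha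
    have e : Limits.Sigma.map (fun i => (p i).map (homOfLE (h.le ha))) ≫
        sigmaComparison ((evaluation J Ab.{u}).obj a) p =
        sigmaComparison ((evaluation J Ab.{u}).obj (r a)) p ≫
          (∐ p).map (homOfLE (h.le ha)) := by
      refine Limits.Sigma.hom_ext _ _ fun i => ?_
      have e1 := ι_comp_sigmaComparison ((evaluation J Ab.{u}).obj a) p i
      have e2 := ι_comp_sigmaComparison ((evaluation J Ab.{u}).obj (r a)) p i
      rw [Limits.Sigma.ι_map_assoc]
      exact ((congrArg _ e1).trans ((Limits.Sigma.ι p i).naturality _)).trans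
        ((congrArg (· ≫ (∐ p).map (homOfLE (h.le ha))) e2).symm.trans (Category.assoc _ _ _))
    have : IsIso (sigmaComparison ((evaluation J Ab.{u}).obj (r a)) p ≫
          (∐ p).map (homOfLE (h.le ha))) := by
      rw [← e]
      infer_instance
    exact IsIso.of_isIso_comp_left (sigmaComparison ((evaluation J Ab.{u}).obj (r a)) p) _

theorem adapted_kernel {P : J ⥤ Ab.{u}} (hP : h.Adapted P) (hG : h.Adapted G) (g : P ⟶ G) :
    h.Adapted (kernel g) where
  isZero a ha := by
    rw [IsZero.iff_id_eq_zero, ← cancel_mono ((kernel.ι g).app a)]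
    exact (hP.isZero a ha).eq_of_tgt _ _
  isIso a ha := by
    have := hP.isIso a ha
    have := hG.isIso a ha
    have nat := (kernel.ι g).naturality (homOfLE (h.le ha))
    have : Mono ((kernel g).map (homOfLE (h.le ha))) := by
      have : Mono ((kernel g).map (homOfLE (h.le ha)) ≫ (kernel.ι g).app a) := by
        rw [nat]
        infer_instance
      exact mono_of_mono _ ((kernel.ι g).app a)
    let e : (kernel g).obj a ⟶ (kernel g).obj (r a) :=
      (isLimitOfHasKernelOfPreservesLimit ((evaluation J Ab.{u}).obj (r a)) g).lift
        (KernelFork.ofι ((kernel.ι g).app a ≫ inv (P.map (homOfLE (h.le ha)))) (by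
          rw [← cancel_mono (G.map (homOfLE (h.le ha)))]
          have := g.naturality (homOfLE (h.le ha))
          simp only [evaluation_obj_map, Category.assoc, zero_comp]
          rw [← this, IsIso.inv_hom_id_assoc, ← NatTrans.comp_app, kernel.condition]
          rfl))
    have he : e ≫ (kernel.ι g).app (r a) =
        (kernel.ι g).app a ≫ inv (P.map (homOfLE (h.le ha))) :=
      Fork.IsLimit.lift_ι _
    have he' : e ≫ (kernel g).map (homOfLE (h.le ha)) = 𝟙 _ := by
      rw [← cancel_mono ((kernel.ι g).app a), Category.assoc, nat, reassoc_of% he,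
        IsIso.inv_hom_id, Category.comp_id, Category.id_comp]
    refine ⟨e, ?_, he'⟩
    rw [← cancel_mono ((kernel g).map (homOfLE (h.le ha))), Category.assoc, he', Category.comp_id,
      Category.id_comp]

/-- An adapted functor is a quotient of an adapted projective functor. -/
theorem Adapted.exists_projective (hG : h.Adapted G) :
    ∃ (P : J ⥤ Ab.{u}) (g : P ⟶ G), Projective P ∧ h.Adapted P ∧ Epi g := by
  let p : {a : J // a ∈ S ∧ r a = a} → (J ⥤ Ab.{u}) := fun a =>
    (evaluationLeftAdjoint Ab.{u} a.1).obj (Projective.over (G.obj a.1))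
  let q : ∀ a, p a ⟶ G := fun a =>
    ((evaluationAdjunctionRight Ab.{u} a.1).homEquiv _ _).symm (Projective.π (G.obj a.1))
  have hp : ∀ a, Projective (p a) := fun a =>
    (evaluationAdjunctionRight Ab.{u} a.1).map_projective _ inferInstance
  have hq : ∀ a, Epi ((q a).app a.1) := fun a => by
    have e : (evaluationAdjunctionRight Ab.{u} a.1).homEquiv _ _ (q a) =
      Projective.π (G.obj a.1) := Equiv.apply_symm_apply _ _
    rw [Adjunction.homEquiv_unit] at e
    have : Epi ((evaluationAdjunctionRight Ab.{u} a.1).unit.app (Projective.over (G.obj a.1)) ≫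
        (q a).app a.1) := by
      rw [show _ ≫ (q a).app a.1 = Projective.π (G.obj a.1) from e]
      infer_instance
    exact epi_of_epi ((evaluationAdjunctionRight Ab.{u} a.1).unit.app _) _
  refine ⟨∐ p, Limits.Sigma.desc q, inferInstance, adapted_sigma h p fun a =>
    adapted_evaluationLeftAdjoint h a.2.1 a.2.2 _, ?_⟩
  rw [NatTrans.epi_iff_epi_app]
  intro a
  by_cases ha : a ∈ S
  · have := hG.isIso a ha
    have e1 : Epi ((Limits.Sigma.desc q).app (r a)) := by
      let i : {a : J // a ∈ S ∧ r a = a} := ⟨r a, h.mem ha, h.idem ha⟩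
      have : Epi ((Limits.Sigma.ι p i).app (r a) ≫ (Limits.Sigma.desc q).app (r a)) := by
        rw [← NatTrans.comp_app, Limits.Sigma.ι_desc]
        exact hq i
      exact epi_of_epi ((Limits.Sigma.ι p i).app (r a)) _
    have e2 : Epi ((∐ p).map (homOfLE (h.le ha)) ≫ (Limits.Sigma.desc q).app a) := by
      rw [(Limits.Sigma.desc q).naturality]
      infer_instance
    exact epi_of_epi ((∐ p).map (homOfLE (h.le ha))) _
  · exact ⟨fun _ _ _ => (hG.isZero a ha).eq_of_src _ _⟩

/-- An adapted functor is acyclic, by dimension shifting in the family of the adapted functors. -/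
theorem Adapted.extAcyclic (hG : h.Adapted G) :
    ExtAcyclic.{u} (Functor.const J) G := by
  refine extAcyclic_of_family (L := colim) colimConstAdj
    (fun G : {G : J ⥤ Ab.{u} // h.Adapted G} => G.1) ?_ ⟨G, hG⟩
  rintro ⟨G, hG⟩
  obtain ⟨P, g, hP, hPa, hg⟩ := Adapted.exists_projective h hG
  refine ⟨⟨kernel g, adapted_kernel h hPa hG g⟩, P, kernel.ι g, g, kernel.condition g, ?_,
    extAcyclic_of_projective _ _, mono_colim_map h (adapted_kernel h hPa hG g) hPa _⟩
  exact { exact := ShortComplex.exact_kernel g }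

end ConicalContraction

end Contraction

/-! ### Walks that avoid a vertex, and the mute vertices of a planted tree -/

section AvoidingWalks

namespace SimpleGraph

variable {V : Type*} {G : SimpleGraph V} {a b c x y z : V}

/-- There is a walk from `x` to `y` that does not pass through `c`. -/
def Avoids (G : SimpleGraph V) (c x y : V) : Prop :=
  ∃ p : G.Walk x y, c ∉ p.support

theorem Avoids.refl (h : x ≠ c) : G.Avoids c x x :=
  ⟨Walk.nil, by simpa using h.symm⟩

theorem Avoids.symm (h : G.Avoids c x y) : G.Avoids c y x := by
  obtain ⟨p, hp⟩ := h
  exact ⟨p.reverse, by simpa using hp⟩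

theorem Avoids.trans (h : G.Avoids c x y) (h' : G.Avoids c y z) : G.Avoids c x z := by
  obtain ⟨p, hp⟩ := h
  obtain ⟨q, hq⟩ := h'
  exact ⟨p.append q, by simp [Walk.mem_support_append_iff, hp, hq]⟩

theorem Avoids.of_adj (h : G.Adj x y) (hx : x ≠ c) (hy : y ≠ c) : G.Avoids c x y :=
  ⟨Walk.cons h Walk.nil, by simp [hx.symm, hy.symm]⟩

theorem Avoids.ne_left (h : G.Avoids c x y) : x ≠ c := by
  obtain ⟨p, hp⟩ := h
  rintro rfl
  exact hp p.start_mem_support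

theorem Avoids.ne_right (h : G.Avoids c x y) : y ≠ c :=
  h.symm.ne_left

theorem Avoids.map {W : Type*} {G' : SimpleGraph W} (f : G →g G') {d : W}
    (hf : ∀ v, f v = d → v = c) (h : G.Avoids c x y) : G'.Avoids d (f x) (f y) := by
  obtain ⟨p, hp⟩ := h
  refine ⟨p.map f, fun h => hp ?_⟩
  rw [Walk.support_map, List.mem_map] at h
  obtain ⟨v, hv, hv'⟩ := h
  exact hf v hv' ▸ hv

/-- Of two vertices `a` and `b` of a connected graph, one is reached from `x` before the other. -/
theorem Connected.avoids_or_avoids (h : G.Connected) (hab : a ≠ b) (x : V) :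
    G.Avoids b x a ∨ G.Avoids a x b := by
  classical
  obtain ⟨p, hp⟩ := h.exists_isPath x a
  by_cases hb : b ∈ p.support
  · exact Or.inr ⟨p.takeUntil b hb, p.endpoint_notMem_support_takeUntil hp hb hab⟩
  · exact Or.inl ⟨p, hb⟩

/-- Two neighbours of a vertex `c` of a forest lie in different components of the graph obtained by
removing `c`. -/
theorem IsAcyclic.eq_of_avoids (h : G.IsAcyclic) (hx : G.Adj c x) (hy : G.Adj c y)
    (hxy : G.Avoids c x y) : x = y := by
  classical
  by_contra hne
  obtain ⟨p, hp⟩ := hxy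
  have h1 : (Walk.cons hx.symm (Walk.cons hy Walk.nil)).IsPath := by
    simp [Walk.cons_isPath_iff, hx.ne', hy.ne, hne]
  have h2 := (h.subsingleton_path x y).elim ⟨_, h1⟩ p.toPath
  have h3 : c ∈ (p.toPath : G.Walk x y).support := by
    rw [← h2]
    simp
  exact hp (p.support_toPath_subset_support h3)

end SimpleGraph

end AvoidingWalks

namespace PlantedTree

open SimpleGraph

variable {E : Type u} (A : PlantedTree E)

/-- Two elements of `Option E` lie in the same component of `A - S_e` when a walk in `A` joins them
and avoids `S_e`. -/
theorem branchSetoid_iff {e : E} {x y : {x : Option E // x ≠ some e}} :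
    A.branchSetoid e x y ↔ A.graph.Avoids (Sum.inl (some e)) (Sum.inl x.1) (Sum.inl y.1) := by
  constructor
  · rintro ⟨p⟩
    refine ⟨p.map (Embedding.induce _).toHom, fun h => ?_⟩
    obtain ⟨v, -, hv⟩ := List.mem_map.1 ((p.support_map (Embedding.induce _).toHom) ▸ h)
    exact v.2 hv
  · rintro ⟨p, hp⟩
    exact ⟨p.induce {v | v ≠ Sum.inl (some e)} fun v hv h => hp (h ▸ hv)⟩

variable {A}

theorem avoids_of_mem {m : Set (Option E)} (hm : m ∈ A.mutes) {x y : Option E} (hx : x ∈ m)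
    (hy : y ∈ m) {e : E} (hxe : x ≠ some e) (hye : y ≠ some e) :
    A.graph.Avoids (Sum.inl (some e)) (Sum.inl x) (Sum.inl y) :=
  let v : Option E ⊕ A.mutes := Sum.inr ⟨m, hm⟩
  (Avoids.of_adj (show A.graph.Adj (Sum.inl x) v from hx) (fun h => hxe (Sum.inl.inj h))
    Sum.inr_ne_inl).trans
    (Avoids.of_adj (show A.graph.Adj v (Sum.inl y) from hy) Sum.inr_ne_inl
      (fun h => hye (Sum.inl.inj h)))

/-- The mute neighbours of `S_e` lie in different components of `A - S_e`. -/
theorem eq_of_avoids {m m' : Set (Option E)} (hm : m ∈ A.mutes) (hm' : m' ∈ A.mutes) {e : E}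
    (he : some e ∈ m) (he' : some e ∈ m') {x y : Option E} (hx : x ∈ m) (hy : y ∈ m')
    (h : A.graph.Avoids (Sum.inl (some e)) (Sum.inl x) (Sum.inl y)) : m = m' := by
  have h1 : A.graph.Avoids (Sum.inl (some e)) (Sum.inr ⟨m, hm⟩) (Sum.inl x) :=
    Avoids.of_adj hx (by simp) h.ne_left
  have h2 : A.graph.Avoids (Sum.inl (some e)) (Sum.inl y) (Sum.inr ⟨m', hm'⟩) :=
    Avoids.of_adj hy h.ne_right (by simp)
  have := A.isTree.isAcyclic.eq_of_avoids (G := A.graph) (c := Sum.inl (some e))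
    (x := Sum.inr ⟨m, hm⟩) (y := Sum.inr ⟨m', hm'⟩) he he' ((h1.trans h).trans h2)
  exact congrArg Subtype.val (Sum.inr.inj this)

theorem eq_of_root_mem {m m' : Set (Option E)} (hm : m ∈ A.mutes) (hm' : m' ∈ A.mutes)
    (h : none ∈ m) (h' : none ∈ m') : m = m' :=
  A.root_unique.unique ⟨hm, h⟩ ⟨hm', h'⟩

theorem eq_of_mem_of_mem {m m' : Set (Option E)} (hm : m ∈ A.mutes) (hm' : m' ∈ A.mutes)
    {x y : Option E} (hxy : x ≠ y) (hx : x ∈ m) (hy : y ∈ m) (hx' : x ∈ m') (hy' : y ∈ m') :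
    m = m' := by
  rcases x with _ | e
  · exact eq_of_root_mem hm hm' hx hx'
  · exact eq_of_avoids hm hm' hx hx' hy hy'
      (Avoids.refl fun h => hxy (Sum.inl.inj h).symm)

/-- Two vertices of `A` other than mute vertices have a common neighbour unless they are separated
by some labelled vertex. -/
theorem exists_mem_of_avoids {x y : Option E} (hxy : x ≠ y)
    (h : ∀ e, x ≠ some e → y ≠ some e →
      A.graph.Avoids (Sum.inl (some e)) (Sum.inl x) (Sum.inl y)) :
    ∃ m ∈ A.mutes, x ∈ m ∧ y ∈ m := by
  obtain ⟨p, hp⟩ := A.isTree.connected.exists_isPath (Sum.inl x) (Sum.inl y)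
  rcases p with _ | ⟨h1, p⟩
  · exact absurd rfl hxy
  rename_i v
  rcases v with v | m
  · exact h1.elim
  rcases p with _ | ⟨h2, p⟩
  rename_i v
  rcases v with z | m'
  swap
  · exact h2.elim
  by_cases hzy : z = y
  · exact ⟨m.1, m.2, h1, hzy ▸ h2⟩
  rcases p with _ | ⟨h3, p⟩
  · exact absurd rfl hzy
  rename_i v
  rcases v with v | m'
  · exact h3.elim
  simp only [Walk.cons_isPath_iff, Walk.support_cons, List.mem_cons, not_or] at hp
  obtain ⟨⟨⟨hp, hzp⟩, hmz, hmp⟩, hxm, hxz, hxp⟩ := hp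
  have hmm : m = m' := by
    rcases z with _ | e
    · exact Subtype.ext (eq_of_root_mem m.2 m'.2 h2 h3)
    · have hxe : x ≠ some e := fun h => hxz (congrArg Sum.inl h)
      have h4 := (h e hxe (Ne.symm hzy)).trans (Avoids.symm ⟨p, hzp⟩)
      have h5 := (Avoids.of_adj (c := Sum.inl (some e)) (show A.graph.Adj (Sum.inr m) (Sum.inl x)
        from h1) (by simp) (fun h => hxe (Sum.inl.inj h))).trans h4
      exact Sum.inr.inj (A.isTree.isAcyclic.eq_of_avoids (G := A.graph)
        (c := Sum.inl (some e)) (x := Sum.inr m) (y := Sum.inr m') h2 h3 h5)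
  exact absurd (hmm ▸ p.start_mem_support) hmp

/-- Helly property: if any two elements of `s` have a common mute neighbour, then there is a mute
vertex adjacent to all the elements of `s`. -/
theorem exists_subset_of_pairwise {s : Set (Option E)} (hs : s.Nontrivial)
    (h : ∀ x ∈ s, ∀ y ∈ s, x ≠ y → ∃ m ∈ A.mutes, x ∈ m ∧ y ∈ m) : ∃ n ∈ A.mutes, s ⊆ n := by
  obtain ⟨x, hx, y, hy, hxy⟩ := hs
  obtain ⟨n, hn, hxn, hyn⟩ := h x hx y hy hxy
  refine ⟨n, hn, fun z hz => ?_⟩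
  by_cases hzx : z = x
  · exact hzx ▸ hxn
  by_cases hzy : z = y
  · exact hzy ▸ hyn
  obtain ⟨n₁, hn₁, hzn₁, hxn₁⟩ := h z hz x hx hzx
  obtain ⟨n₂, hn₂, hzn₂, hyn₂⟩ := h z hz y hy hzy
  suffices n = n₁ from this ▸ hzn₁
  rcases x with _ | e
  · exact eq_of_root_mem hn hn₁ hxn hxn₁
  · exact eq_of_avoids hn hn₁ hxn hxn₁ hyn hzn₁ (avoids_of_mem hn₂ hyn₂ hzn₂ (Ne.symm hxy) hzx)

/-- The preorder on trees for which `A` is below `A'` if each mute vertex of `A'` is contained in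
a mute vertex of `A`. It turns out to be the folding order. -/
def Refines (A' A : PlantedTree E) : Prop :=
  ∀ m ∈ A'.mutes, ∃ n ∈ A.mutes, m ⊆ n

theorem Refines.antisymm {A A' : PlantedTree E} (h : Refines A A') (h' : Refines A' A) :
    A = A' := by
  have key : ∀ {A A' : PlantedTree E}, Refines A A' → Refines A' A → A.mutes ⊆ A'.mutes := by
    intro A A' h h' m hm
    obtain ⟨n, hn, hmn⟩ := h m hm
    obtain ⟨m', hm', hnm⟩ := h' n hn
    obtain ⟨x, hx, y, hy, hxy⟩ := A.not_leaf m hm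
    have : m = m' := eq_of_mem_of_mem hm hm' hxy hx hy (hnm (hmn hx)) (hnm (hmn hy))
    have : m = n := hmn.antisymm (this ▸ hnm)
    exact this ▸ hn
  exact PlantedTree.ext ((key h h').antisymm (key h' h))

theorem Refines.avoids {A A' : PlantedTree E} (h : Refines A' A) {e : E} {x y : Option E}
    (hxy : A'.graph.Avoids (Sum.inl (some e)) (Sum.inl x) (Sum.inl y)) :
    A.graph.Avoids (Sum.inl (some e)) (Sum.inl x) (Sum.inl y) := by
  choose f hf hsub using fun m : ↥A'.mutes => h m.1 m.2
  let g : A'.graph →g A.graph :=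
    { toFun := Sum.map id fun m => ⟨f m, hf m⟩
      map_rel' := by
        rintro (x | m) (y | n) hadj
        · exact hadj
        · exact hsub n hadj
        · exact hsub m hadj
        · exact hadj }
  refine Avoids.map g ?_ hxy
  rintro (v | v) hv
  · exact congrArg Sum.inl (Sum.inl.inj hv)
  · cases hv

/-- The neighbours of a mute vertex of `A'` are not separated by any labelled vertex in `A'`, hence
not in `A` either; by the Helly property they are adjacent to one mute vertex of `A`. -/
theorem refines_of_branchSetoid_le {A A' : PlantedTree E}
    (h : ∀ e, A'.branchSetoid e ≤ A.branchSetoid e) : Refines A' A := by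
  intro m hm
  refine exists_subset_of_pairwise (A'.not_leaf m hm) fun x hx y hy hxy =>
    exists_mem_of_avoids hxy fun e hxe hye => ?_
  exact A.branchSetoid_iff.1 (h e ((A'.branchSetoid_iff (x := ⟨x, hxe⟩) (y := ⟨y, hye⟩)).2
    (avoids_of_mem hm hx hy hxe hye)))

/-- If `A` is strictly below `A'`, then two mute vertices of `A'` with a common labelled neighbour
are contained in the same mute vertex of `A`. -/
theorem Refines.exists_foldable {A A' : PlantedTree E} (h : Refines A' A) (hne : A ≠ A') :
    ∃ (e : E) (m m' n : Set (Option E)), m ∈ A'.mutes ∧ m' ∈ A'.mutes ∧ m ≠ m' ∧ some e ∈ m ∧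
      some e ∈ m' ∧ n ∈ A.mutes ∧ m ∪ m' ⊆ n := by
  by_contra hno
  push Not at hno
  refine hne (Refines.antisymm (fun n hn => exists_subset_of_pairwise (A.not_leaf n hn)
    fun x hx y hy hxy => exists_mem_of_avoids hxy fun e hxe hye => ?_) h)
  -- Otherwise the mute neighbours of `S_e` in `A'` through which `x` and `y` are reached lie in
  -- different mute vertices of `A`, so `S_e` separates `x` from `y` in `A` too.
  have first : ∀ x : Option E, x ≠ some e → ∃ m ∈ A'.mutes, some e ∈ m ∧ ∃ z ∈ m,
      A'.graph.Avoids (Sum.inl (some e)) (Sum.inl x) (Sum.inl z) := by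
    intro x hxe
    obtain ⟨p, hp⟩ := A'.isTree.connected.exists_isPath (Sum.inl (some e)) (Sum.inl x)
    rcases p with _ | ⟨h1, p⟩
    · exact absurd rfl hxe
    rename_i v
    rcases v with v | m
    · exact h1.elim
    rcases p with _ | ⟨h2, p⟩
    rename_i v
    rcases v with z | m'
    swap
    · exact h2.elim
    simp only [Walk.cons_isPath_iff, Walk.support_cons, List.mem_cons, not_or] at hp
    exact ⟨m.1, m.2, h1, z, h2, Avoids.symm ⟨p, hp.2.2⟩⟩
  obtain ⟨m, hm, hem, z, hz, hxz⟩ := first x hxe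
  obtain ⟨m', hm', hem', z', hz', hyz⟩ := first y hye
  by_cases hmm : m = m'
  · subst hmm
    exact hxz.trans ((avoids_of_mem hm hz hz' (fun h => hxz.ne_right (congrArg Sum.inl h))
      (fun h => hyz.ne_right (congrArg Sum.inl h))).trans hyz.symm)
  · obtain ⟨n₁, hn₁, hmn₁⟩ := h m hm
    obtain ⟨n₂, hn₂, hmn₂⟩ := h m' hm'
    have : n₁ = n₂ := eq_of_avoids hn₁ hn₂ (hmn₁ hem) (hmn₂ hem') (hmn₁ hz) (hmn₂ hz')
      ((h.avoids hxz.symm).trans ((avoids_of_mem hn hx hy hxe hye).trans (h.avoids hyz)))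
    exact absurd (Set.union_subset hmn₁ (this ▸ hmn₂)) (hno e m m' n₁ hm hm' hmm hem hem' hn₁)

end PlantedTree

/-! ### The folding order is the order by refinement of partitions -/

namespace PlantedTree

open SimpleGraph

variable {E : Type u}

open Classical in
/-- Folding two mute neighbours of a labelled vertex of a planted tree yields a planted tree. -/
theorem exists_isFold [Finite E] (A' : PlantedTree E) {e : E} {m m' : Set (Option E)}
    (hm : m ∈ A'.mutes) (hm' : m' ∈ A'.mutes) (hne : m ≠ m') (he : some e ∈ m)
    (he' : some e ∈ m') :
    ∃ A : PlantedTree E, A.mutes = insert (m ∪ m') (A'.mutes \ {m, m'}) := by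
  let M : Set (Set (Option E)) := insert (m ∪ m') (A'.mutes \ {m, m'})
  have hM : ∀ n : A'.mutes, (if n.1 = m ∨ n.1 = m' then m ∪ m' else n.1) ∈ M := by
    intro n
    split_ifs with h
    · exact Set.mem_insert _ _
    · exact Set.mem_insert_of_mem _ ⟨n.2, h⟩
  let φ : A'.graph →g incidenceGraph M :=
    { toFun := Sum.map id fun n => ⟨_, hM n⟩
      map_rel' := by
        have key : ∀ (x : Option E) (n : A'.mutes), x ∈ n.1 →
            x ∈ (if n.1 = m ∨ n.1 = m' then m ∪ m' else n.1) := by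
          intro x n hx
          split_ifs with h
          · rcases h with h | h
            · exact Or.inl (h ▸ hx)
            · exact Or.inr (h ▸ hx)
          · exact hx
        rintro (x | n) (y | n') hadj
        · exact hadj
        · exact key _ _ hadj
        · exact key _ _ hadj
        · exact hadj }
  have φm : φ (Sum.inr ⟨m, hm⟩) = Sum.inr ⟨m ∪ m', Set.mem_insert _ _⟩ :=
    congrArg Sum.inr (Subtype.ext (if_pos (Or.inl rfl)))
  have φm' : φ (Sum.inr ⟨m', hm'⟩) = Sum.inr ⟨m ∪ m', Set.mem_insert _ _⟩ :=
    congrArg Sum.inr (Subtype.ext (if_pos (Or.inr rfl)))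
  have φn : ∀ n (hn : n ∈ A'.mutes \ {m, m'}),
      φ (Sum.inr ⟨n, hn.1⟩) = Sum.inr ⟨n, Set.mem_insert_of_mem _ hn⟩ := fun n hn =>
    congrArg Sum.inr (Subtype.ext (if_neg hn.2))
  have hsurj : Function.Surjective φ := by
    rintro (x | ⟨n, rfl | hn⟩)
    · exact ⟨Sum.inl x, rfl⟩
    · exact ⟨_, φm⟩
    · exact ⟨_, φn n hn⟩
  have hconn : (incidenceGraph M).Connected := A'.isTree.connected.map φ hsurj
  -- The fold removes one vertex and at least one edge.
  have hcardM : M.ncard + 1 = A'.mutes.ncard := by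
    have h1 : m ∪ m' ∉ A'.mutes \ {m, m'} := by
      rintro ⟨h2, h3⟩
      obtain ⟨x, hx, hxe⟩ := (A'.not_leaf m hm).exists_ne (some e)
      exact h3 (Or.inl (eq_of_mem_of_mem h2 hm hxe (Or.inl hx) (Or.inl he) hx he))
    have h2 : (A'.mutes \ {m, m'}).ncard + 2 = A'.mutes.ncard := by
      rw [← Set.ncard_pair hne]
      exact Set.ncard_sdiff_add_ncard_of_subset (by rintro x (rfl | rfl) <;> assumption)
    rw [Set.ncard_insert_of_notMem h1]
    omega
  have hedges : (incidenceGraph M).edgeSet.ncard + 1 ≤ A'.graph.edgeSet.ncard := by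
    have h1 : (incidenceGraph M).edgeSet ⊆ Sym2.map φ ''
        (A'.graph.edgeSet \ {s(Sum.inl (some e), Sum.inr ⟨m', hm'⟩)}) := by
      have key : ∀ (x : Option E) (n : M), x ∈ n.1 → s(Sum.inl x, Sum.inr n) ∈ Sym2.map φ ''
          (A'.graph.edgeSet \ {s(Sum.inl (some e), Sum.inr ⟨m', hm'⟩)}) := by
        rintro x ⟨n, rfl | hn⟩ hx
        · by_cases hxm : x ∈ m
          · refine ⟨s(Sum.inl x, Sum.inr ⟨m, hm⟩), ⟨hxm, ?_⟩, ?_⟩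
            · intro h
              rcases Sym2.eq_iff.1 h with ⟨-, h⟩ | ⟨h, -⟩
              · exact hne (congrArg Subtype.val (Sum.inr.inj h))
              · cases h
            · rw [Sym2.map_mk, φm]
              rfl
          · have hxm' := Or.resolve_left hx hxm
            refine ⟨s(Sum.inl x, Sum.inr ⟨m', hm'⟩), ⟨hxm', ?_⟩, ?_⟩
            · intro h
              rcases Sym2.eq_iff.1 h with ⟨h, -⟩ | ⟨h, -⟩
              · exact hxm (Sum.inl.inj h ▸ he)
              · cases h
            · rw [Sym2.map_mk, φm']
              rfl
        · refine ⟨s(Sum.inl x, Sum.inr ⟨n, hn.1⟩), ⟨hx, ?_⟩, ?_⟩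
          · intro h
            rcases Sym2.eq_iff.1 h with ⟨-, h⟩ | ⟨h, -⟩
            · exact hn.2 (Or.inr (congrArg Subtype.val (Sum.inr.inj h)))
            · cases h
          · rw [Sym2.map_mk, φn n hn]
            rfl
      intro d
      induction d using Sym2.ind with
      | _ v w =>
        intro h
        rcases v with x | n <;> rcases w with y | n'
        · exact h.elim
        · exact key x n' h
        · exact Sym2.eq_swap (a := Sum.inl y) (b := Sum.inr n) ▸ key y n h
        · exact h.elim
    have h2 := (Set.ncard_le_ncard h1 (Set.toFinite _)).trans (Set.ncard_image_le (Set.toFinite _))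
    have h3 : s(Sum.inl (some e), Sum.inr ⟨m', hm'⟩) ∈ A'.graph.edgeSet := he'
    have h4 := Set.ncard_sdiff_singleton_add_one h3 (Set.toFinite _)
    omega
  have htree : (incidenceGraph M).IsTree := by
    rw [isTree_iff_connected_and_card]
    refine ⟨hconn, le_antisymm ?_ hconn.card_vert_le_card_edgeSet_add_one⟩
    have h1 : Nat.card A'.graph.edgeSet + 1 = Nat.card (Option E ⊕ A'.mutes) :=
      (isTree_iff_connected_and_card.1 A'.isTree).2
    rw [Nat.card_sum, Nat.card_coe_set_eq, Nat.card_coe_set_eq] at h1 ⊢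
    omega
  refine ⟨⟨M, htree, ?_, ?_⟩, rfl⟩
  · rintro n (rfl | hn)
    · exact (A'.not_leaf m hm).mono Set.subset_union_left
    · exact A'.not_leaf n hn.1
  · obtain ⟨n, ⟨hn, hn0⟩, -⟩ := A'.root_unique
    have hroot : none ∈ m ∪ m' → ∀ n' ∈ A'.mutes \ {m, m'}, none ∉ n' := by
      rintro (h | h) n' hn' h'
      · exact hn'.2 (Or.inl (eq_of_root_mem hn'.1 hm h' h))
      · exact hn'.2 (Or.inr (eq_of_root_mem hn'.1 hm' h' h))
    have huniq : ∀ n₁ ∈ M, ∀ n₂ ∈ M, none ∈ n₁ → none ∈ n₂ → n₁ = n₂ := by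
      rintro n₁ (rfl | h₁) n₂ (rfl | h₂) h0 h0'
      · rfl
      · exact absurd h0' (hroot h0 _ h₂)
      · exact absurd h0 (hroot h0' _ h₁)
      · exact eq_of_root_mem h₁.1 h₂.1 h0 h0'
    by_cases h : n = m ∨ n = m'
    · have : none ∈ m ∪ m' := by
        rcases h with rfl | rfl
        · exact Or.inl hn0
        · exact Or.inr hn0
      exact ⟨_, ⟨Set.mem_insert _ _, this⟩, fun n' hn' =>
        huniq n' hn'.1 _ (Set.mem_insert _ _) hn'.2 this⟩
    · have : n ∈ M := Set.mem_insert_of_mem _ ⟨hn, h⟩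
      exact ⟨n, ⟨this, hn0⟩, fun n' hn' => huniq n' hn'.1 n this hn'.2 hn0⟩

/-- If `A ≠ A'`, fold two mute vertices of `A'` that lie in the same mute vertex of `A`; the result
still refines `A`, and has fewer mute vertices. -/
theorem le_of_refines [Finite E] {A A' : PlantedTree E} (h : Refines A' A) : A ≤ A' := by
  induction hn : A'.mutes.ncard using Nat.strong_induction_on generalizing A' with
  | _ k ih =>
    by_cases hne : A = A'
    · exact hne.le
    obtain ⟨e, m, m', n, hm, hm', hmm, he, he', hn', hsub⟩ := h.exists_foldable hne
    obtain ⟨A'', hA''⟩ := exists_isFold A' hm hm' hmm he he'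
    have hfold : IsFold A' A'' := ⟨e, m, m', hm, hm', hmm, he, he', hA''⟩
    have h1 : A ≤ A'' := by
      refine ih _ (hn ▸ hfold.ncard_lt) (fun k hk => ?_) rfl
      rw [hA''] at hk
      rcases hk with rfl | hk
      · exact ⟨n, hn', hsub⟩
      · exact h k hk.1
    exact h1.trans (le_iff.2 (Relation.ReflTransGen.single hfold))

theorem le_iff_branchSetoid_le [Finite E] {A A' : PlantedTree E} :
    A ≤ A' ↔ ∀ e, A'.branchSetoid e ≤ A.branchSetoid e :=
  ⟨fun h e => branchSetoid_le h e, fun h => le_of_refines (refines_of_branchSetoid_le h)⟩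

end PlantedTree

/-! ### Nestings -/

/-- A family `(ρ_e)` of partial equivalence relations on `E`, the combinatorial counterpart of a
planted tree: `ρ_e v w` means that `v` and `w` are descendants of `e` in the same branch at `e`.
In particular `ρ_e v v` means that `e` is an ancestor of `v`. -/
structure Nesting (E : Type u) where
  /-- the partial equivalence relations -/
  rel : E → E → E → Prop
  symm : ∀ {e v w}, rel e v w → rel e w v
  trans : ∀ {e v w x}, rel e v w → rel e w x → rel e v x
  irrefl : ∀ e, ¬ rel e e e
  rel_of_anc : ∀ {e v w}, rel e v v → rel v w w → rel e v w
  chain : ∀ {a b v}, rel a v v → rel b v v → a ≠ b → rel a b b ∨ rel b a a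

namespace Nesting

variable {E : Type u} (ρ : Nesting E)

/-- `e` is a (strict) ancestor of `v`. -/
def Anc (e v : E) : Prop := ρ.rel e v v

variable {ρ} {a b e v w x : E}

theorem rel_left (h : ρ.rel e v w) : ρ.Anc e v := ρ.trans h (ρ.symm h)

theorem rel_right (h : ρ.rel e v w) : ρ.Anc e w := ρ.trans (ρ.symm h) h

theorem Anc.trans (h : ρ.Anc a b) (h' : ρ.Anc b v) : ρ.Anc a v := rel_right (ρ.rel_of_anc h h')

theorem Anc.ne (h : ρ.Anc a b) : a ≠ b := by
  rintro rfl
  exact ρ.irrefl _ h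

theorem Anc.not_anc (h : ρ.Anc a b) : ¬ ρ.Anc b a := fun h' => ρ.irrefl _ (h.trans h')

variable (ρ) in
/-- The number of ancestors. -/
noncomputable def depth (v : E) : ℕ := {a | ρ.Anc a v}.ncard

theorem Anc.depth_lt [Finite E] (h : ρ.Anc a v) : ρ.depth a < ρ.depth v :=
  Set.ncard_lt_ncard ⟨fun _ hb => Anc.trans hb h, fun h' => ρ.irrefl a (h' h)⟩

variable (ρ) in
/-- `e` is the closest ancestor of `v`. -/
def IsParent (e v : E) : Prop := ρ.Anc e v ∧ ∀ a, ρ.Anc a v → a ≠ e → ρ.Anc a e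

theorem IsParent.unique (h : ρ.IsParent a v) (h' : ρ.IsParent b v) : a = b := by
  by_contra hne
  exact (h.2 b h'.1 (Ne.symm hne)).not_anc (h'.2 a h.1 hne)

theorem exists_isParent [Finite E] (h : ρ.Anc e v) : ∃ p, ρ.IsParent p v := by
  obtain ⟨p, hp, hmax⟩ := Set.exists_max_image {a | ρ.Anc a v} ρ.depth (Set.toFinite _) ⟨e, h⟩
  refine ⟨p, hp, fun a ha hap => ?_⟩
  rcases ρ.chain ha hp hap with h' | h'
  · exact h'
  · exact absurd (Anc.depth_lt h') (not_lt.2 (hmax a ha))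

/-- The child of `e` above a given descendant `v` of `e`. -/
theorem exists_child [Finite E] (h : ρ.Anc e v) :
    ∃ x, ρ.IsParent e x ∧ (x = v ∨ ρ.Anc x v) := by
  obtain ⟨x, hx, hmin⟩ := Set.exists_min_image {x | ρ.Anc e x ∧ (x = v ∨ ρ.Anc x v)} ρ.depth
    (Set.toFinite _) ⟨v, h, Or.inl rfl⟩
  refine ⟨x, ⟨hx.1, fun a ha hae => ?_⟩, hx.2⟩
  rcases ρ.chain ha hx.1 hae with h' | h'
  · exact h'
  · refine absurd ha.depth_lt (not_lt.2 (hmin a ⟨h', Or.inr ?_⟩))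
    rcases hx.2 with rfl | h2
    · exact ha
    · exact ha.trans h2

theorem rel_of_eq_or_anc (h : ρ.Anc e x) (h' : x = v ∨ ρ.Anc x v) : ρ.rel e x v := by
  rcases h' with rfl | h'
  · exact h
  · exact ρ.rel_of_anc h h'

variable (ρ) in
/-- `v` and `w` lie in the same branch at every vertex; this means that they are attached to their
parent through the same mute vertex. -/
def siblings : Setoid E where
  r v w := ∀ e x, ρ.rel e v x ↔ ρ.rel e w x
  iseqv := ⟨fun _ _ _ => Iff.rfl, fun h e x => (h e x).symm, fun h h' e x =>
    (h e x).trans (h' e x)⟩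

theorem siblings_anc (h : ρ.siblings v w) : ρ.Anc e v ↔ ρ.Anc e w :=
  ⟨fun h' => rel_right (ρ.symm ((h e v).1 h')), fun h' => rel_right (ρ.symm ((h e w).2 h'))⟩

theorem siblings_isParent (h : ρ.siblings v w) : ρ.IsParent e v ↔ ρ.IsParent e w := by
  unfold IsParent
  simp only [siblings_anc h]

theorem siblings_depth (h : ρ.siblings v w) : ρ.depth v = ρ.depth w := by
  unfold depth
  simp only [siblings_anc h]

/-- Two children of `e` in the same branch at `e` lie in the same branch at every vertex. -/
theorem siblings_of_rel (hv : ρ.IsParent e v) (hw : ρ.IsParent e w) (h : ρ.rel e v w) :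
    ρ.siblings v w := by
  have key : ∀ {v w}, ρ.IsParent e v → ρ.IsParent e w → ρ.rel e v w →
      ∀ a x, ρ.rel a v x → ρ.rel a w x := by
    intro v w hv hw h a x hx
    by_cases hae : a = e
    · subst hae
      exact ρ.trans (ρ.symm h) hx
    · have hae' := hv.2 a (rel_left hx) hae
      exact ρ.trans (ρ.trans (ρ.symm (ρ.rel_of_anc hae' hw.1)) (ρ.rel_of_anc hae' hv.1)) hx
  exact fun a x => ⟨key hv hw h a x, key hw hv (ρ.symm h) a x⟩

theorem siblings_of_forall_not_anc (hv : ∀ e, ¬ ρ.Anc e v) (hw : ∀ e, ¬ ρ.Anc e w) :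
    ρ.siblings v w := fun e _ => ⟨fun h => absurd (rel_left h) (hv e),
      fun h => absurd (rel_left h) (hw e)⟩

variable (ρ) in
/-- `x` is the closest ancestor of `v`, or the root if `v` has no ancestor. -/
def IsParentOrRoot (x : Option E) (v : E) : Prop :=
  match x with
  | some e => ρ.IsParent e v
  | none => ∀ e, ¬ ρ.Anc e v

theorem exists_isParentOrRoot [Finite E] (v : E) : ∃ x, ρ.IsParentOrRoot x v := by
  by_cases h : ∃ e, ρ.Anc e v
  · obtain ⟨e, he⟩ := h
    obtain ⟨p, hp⟩ := exists_isParent he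
    exact ⟨some p, hp⟩
  · exact ⟨none, fun e he => h ⟨e, he⟩⟩

theorem isParentOrRoot_unique {x y : Option E} (hx : ρ.IsParentOrRoot x v)
    (hy : ρ.IsParentOrRoot y v) : x = y := by
  rcases x with _ | x <;> rcases y with _ | y
  · rfl
  · exact absurd hy.1 (hx y)
  · exact absurd hx.1 (hy x)
  · exact congrArg some (IsParent.unique hx hy)

theorem siblings_isParentOrRoot {x : Option E} (h : ρ.siblings v w) :
    ρ.IsParentOrRoot x v ↔ ρ.IsParentOrRoot x w := by
  rcases x with _ | x
  · simp only [IsParentOrRoot, siblings_anc h]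
  · exact siblings_isParent h

variable (ρ) in
/-- The neighbours of the mute vertex through which `v` is attached to its parent. -/
def muteAbove (v : E) : Set (Option E) :=
  {x | ρ.IsParentOrRoot x v ∨ ∃ w, x = some w ∧ ρ.siblings v w}

theorem mem_muteAbove_self (v : E) : some v ∈ ρ.muteAbove v := Or.inr ⟨v, rfl, Setoid.refl' _ v⟩

theorem muteAbove_eq_iff : ρ.muteAbove v = ρ.muteAbove w ↔ ρ.siblings v w := by
  constructor
  · intro h
    have h1 : some v ∈ ρ.muteAbove w := h ▸ mem_muteAbove_self v
    have h2 : some w ∈ ρ.muteAbove v := h ▸ mem_muteAbove_self w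
    rcases h1 with h1 | ⟨_, h1, h1'⟩
    · rcases h2 with h2 | ⟨_, h2, h2'⟩
      · exact absurd h2.1 h1.1.not_anc
      · obtain rfl := Option.some.inj h2
        exact h2'
    · obtain rfl := Option.some.inj h1
      exact Setoid.symm' _ h1'
  · intro h
    ext x
    unfold muteAbove
    rw [Set.mem_ofPred_eq, Set.mem_ofPred_eq, siblings_isParentOrRoot h]
    refine or_congr_right (exists_congr fun y => and_congr_right fun _ => ?_)
    exact ⟨fun h' => Setoid.trans' _ (Setoid.symm' _ h) h', fun h' => Setoid.trans' _ h h'⟩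

variable (ρ) in
/-- The mute vertices of the planted tree attached to a nesting. -/
def mutes : Set (Set (Option E)) := Set.range ρ.muteAbove

theorem muteAbove_mem (v : E) : ρ.muteAbove v ∈ ρ.mutes := ⟨v, rfl⟩

end Nesting

open SimpleGraph in
/-- A graph is a tree when each vertex other than a given one `r` has a parent, of lower rank, and
all edges join a vertex to its parent. -/
theorem SimpleGraph.isTree_of_parent {V : Type*} [Finite V] {G : SimpleGraph V} (r : V)
    (parent : V → V) (rank : V → ℕ) (hadj : ∀ v, v ≠ r → G.Adj v (parent v))
    (hrank : ∀ v, v ≠ r → rank (parent v) < rank v)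
    (h : ∀ v w, G.Adj v w → v ≠ r ∧ parent v = w ∨ w ≠ r ∧ parent w = v) : G.IsTree := by
  have hreach : ∀ n v, rank v = n → G.Reachable v r := by
    intro n
    induction n using Nat.strong_induction_on with
    | _ n ih =>
      intro v hv
      by_cases hvr : v = r
      · exact hvr ▸ Reachable.refl _
      · exact (hadj v hvr).reachable.trans (ih _ (hv ▸ hrank v hvr) _ rfl)
  have hconn : G.Connected :=
    { preconnected := fun v w => (hreach _ v rfl).trans (hreach _ w rfl).symm
      nonempty := ⟨r⟩ }
  rw [isTree_iff_connected_and_card]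
  refine ⟨hconn, le_antisymm ?_ hconn.card_vert_le_card_edgeSet_add_one⟩
  have h1 : G.edgeSet ⊆ (fun v => s(v, parent v)) '' {r}ᶜ := by
    intro d
    induction d using Sym2.ind with
    | _ v w =>
      intro hd
      rcases h v w hd with ⟨hv, rfl⟩ | ⟨hw, rfl⟩
      · exact ⟨v, hv, rfl⟩
      · exact ⟨w, hw, Sym2.eq_swap⟩
  have h2 := (Set.ncard_le_ncard h1 (Set.toFinite _)).trans (Set.ncard_image_le (Set.toFinite _))
  have h3 := Set.ncard_add_ncard_compl ({r} : Set V)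
  rw [Set.ncard_singleton] at h3
  rw [Nat.card_coe_set_eq]
  omega

/-! ### Planted trees and nestings -/

/-- A function that is constant on the edges not containing `c` is constant along the walks that
avoid `c`. -/
theorem SimpleGraph.Avoids.apply_eq {V α : Type*} {G : SimpleGraph V} {c x y : V}
    (h : G.Avoids c x y) (f : V → α) (hf : ∀ a b, G.Adj a b → a ≠ c → b ≠ c → f a = f b) :
    f x = f y := by
  obtain ⟨p, hp⟩ := h
  induction p with
  | nil => rfl
  | cons h p ih =>
    simp only [Walk.support_cons, List.mem_cons, not_or] at hp
    exact (hf _ _ h (Ne.symm hp.1) (fun h => hp.2 (h ▸ p.start_mem_support))).trans (ih hp.2)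

namespace Nesting

open SimpleGraph

variable {E : Type u} [Finite E] (ρ : Nesting E)

/-- The parent of a label `v` is the mute vertex `muteAbove v`, and the parent of this mute vertex
is the parent of `v` for the nesting, or the root. -/
theorem isTree_mutes : (incidenceGraph ρ.mutes).IsTree := by
  choose par hpar using ρ.exists_isParentOrRoot
  choose rep hrep using fun m : ρ.mutes => m.2
  have hsib : ∀ v, ρ.siblings (rep ⟨_, ρ.muteAbove_mem v⟩) v := fun v =>
    muteAbove_eq_iff.1 (hrep _)
  let parent : Option E ⊕ ρ.mutes → Option E ⊕ ρ.mutes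
    | Sum.inl none => Sum.inl none
    | Sum.inl (some v) => Sum.inr ⟨_, ρ.muteAbove_mem v⟩
    | Sum.inr m => Sum.inl (par (rep m))
  let rank : Option E ⊕ ρ.mutes → ℕ
    | Sum.inl none => 0
    | Sum.inl (some v) => 2 * ρ.depth v + 2
    | Sum.inr m => 2 * ρ.depth (rep m) + 1
  have hpm : ∀ m : ρ.mutes, par (rep m) ∈ m.1 := fun m => by
    rw [← hrep m]
    exact Or.inl (hpar _)
  refine isTree_of_parent (Sum.inl none) parent rank ?_ ?_ ?_
  · rintro ((_ | v) | m) hv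
    · exact absurd rfl hv
    · exact mem_muteAbove_self v
    · exact hpm m
  · rintro ((_ | v) | m) hv
    · exact absurd rfl hv
    · simp only [rank, parent, siblings_depth (hsib v)]
      omega
    · simp only [rank, parent]
      have := hpar (rep m)
      rcases hp : par (rep m) with _ | p
      · simp
      · rw [hp] at this
        have := this.1.depth_lt
        simp only
        omega
  · have key : ∀ (x : Option E) (m : ρ.mutes), x ∈ m.1 →
        Sum.inl x ≠ (Sum.inl none : Option E ⊕ ρ.mutes) ∧ parent (Sum.inl x) = Sum.inr m ∨
          Sum.inr m ≠ (Sum.inl none : Option E ⊕ ρ.mutes) ∧ parent (Sum.inr m) = Sum.inl x := by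
      intro x m hx
      rw [← hrep m] at hx
      rcases hx with hx | ⟨w, rfl, hw⟩
      · exact Or.inr ⟨Sum.inr_ne_inl, congrArg Sum.inl (isParentOrRoot_unique (hpar _) hx)⟩
      · refine Or.inl ⟨by simp, congrArg Sum.inr (Subtype.ext ?_)⟩
        change ρ.muteAbove w = m.1
        rw [← hrep m]
        exact muteAbove_eq_iff.2 (Setoid.symm' _ hw)
    rintro (x | m) (y | n) h
    · exact h.elim
    · exact key x n h
    · exact (key y m h).symm
    · exact h.elim

/-- The planted tree attached to a nesting. -/
def toTree [Nonempty E] : PlantedTree E where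
  mutes := ρ.mutes
  isTree := ρ.isTree_mutes
  not_leaf := by
    rintro _ ⟨v, rfl⟩
    obtain ⟨x, hx⟩ := ρ.exists_isParentOrRoot v
    refine ⟨x, Or.inl hx, some v, mem_muteAbove_self v, ?_⟩
    rintro rfl
    exact ρ.irrefl v hx.1
  root_unique := by
    obtain ⟨v, -, hv⟩ := Set.exists_min_image Set.univ ρ.depth (Set.toFinite _) Set.univ_nonempty
    have hv0 : ∀ e, ¬ ρ.Anc e v := fun e he => absurd he.depth_lt (not_lt.2 (hv e trivial))
    refine ⟨ρ.muteAbove v, ⟨ρ.muteAbove_mem v, Or.inl hv0⟩, ?_⟩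
    rintro _ ⟨⟨w, rfl⟩, hw | ⟨_, hw, -⟩⟩
    · exact muteAbove_eq_iff.2 (siblings_of_forall_not_anc hw hv0)
    · cases hw

end Nesting

namespace PlantedTree

open SimpleGraph

variable {E : Type u}

theorem nonempty_label (A : PlantedTree E) : Nonempty E := by
  obtain ⟨m, ⟨hm, -⟩, -⟩ := A.root_unique
  obtain ⟨x, -, hx⟩ := (A.not_leaf m hm).exists_ne none
  obtain ⟨e, rfl⟩ := Option.ne_none_iff_exists'.1 hx
  exact ⟨e⟩

/-- The nesting attached to a planted tree: `v` and `w` are related by the relation of index `e`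
when they lie in the same component of `A - S_e`, and this is not the component of the root. -/
def nesting (A : PlantedTree E) : Nesting E where
  rel e v w := A.graph.Avoids (Sum.inl (some e)) (Sum.inl (some v)) (Sum.inl (some w)) ∧
    ¬ A.graph.Avoids (Sum.inl (some e)) (Sum.inl (some v)) (Sum.inl none)
  symm h := ⟨h.1.symm, fun h' => h.2 (h.1.trans h')⟩
  trans h h' := ⟨h.1.trans h'.1, h.2⟩
  irrefl e h := h.1.ne_left rfl
  rel_of_anc {e v w} h h' := by
    refine ⟨?_, h.2⟩
    have hve : Sum.inl (some v) ≠ Sum.inl (some e) := h.1.ne_left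
    rcases A.isTree.connected.avoids_or_avoids hve (Sum.inl (some w)) with h1 | h1
    · exact h1.symm
    rcases A.isTree.connected.avoids_or_avoids hve (Sum.inl none) with h2 | h2
    · exact absurd h2.symm h.2
    · exact absurd (h1.trans h2.symm) h'.2
  chain {a b v} h h' hab := by
    have hab' : (Sum.inl (some a) : Option E ⊕ A.mutes) ≠ Sum.inl (some b) := by simpa using hab
    rcases A.isTree.connected.avoids_or_avoids hab' (Sum.inl (some v)) with h1 | h1
    · exact Or.inr ⟨Avoids.refl hab', fun h2 => h'.2 (h1.trans h2)⟩
    · exact Or.inl ⟨Avoids.refl hab'.symm, fun h2 => h.2 (h1.trans h2)⟩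

variable {A : PlantedTree E}

theorem nesting_anc_iff {e v : E} : A.nesting.Anc e v ↔ v ≠ e ∧
    ¬ A.graph.Avoids (Sum.inl (some e)) (Sum.inl (some v)) (Sum.inl none) :=
  ⟨fun h => ⟨fun h' => h.1.ne_left (by rw [h']), h.2⟩,
    fun h => ⟨Avoids.refl (by simpa using h.1), h.2⟩⟩

end PlantedTree

namespace Nesting

open SimpleGraph PlantedTree

variable {E : Type u} [Finite E] [Nonempty E] {ρ : Nesting E}

theorem avoids_toTree_root {e v : E} (hve : v ≠ e) (h : ¬ ρ.Anc e v) :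
    ρ.toTree.graph.Avoids (Sum.inl (some e)) (Sum.inl (some v)) (Sum.inl none) := by
  induction hn : ρ.depth v using Nat.strong_induction_on generalizing v with
  | _ n ih =>
    obtain ⟨x, hx⟩ := ρ.exists_isParentOrRoot v
    have hve' : some v ≠ some e := by simpa using hve
    have hxe : x ≠ some e := by
      rintro rfl
      exact h hx.1
    have h1 := avoids_of_mem (A := ρ.toTree) (ρ.muteAbove_mem v) (mem_muteAbove_self v)
      (Or.inl hx) hve' hxe
    rcases x with _ | p
    · exact h1
    · have hp : ρ.Anc p v := hx.1
      exact h1.trans (ih _ (hn ▸ hp.depth_lt) (by simpa using hxe) (fun h' => h (h'.trans hp)) rfl)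

theorem exists_avoids_toTree_child {e v : E} (h : ρ.Anc e v) :
    ∃ x, ρ.IsParent e x ∧ ρ.rel e x v ∧
      ρ.toTree.graph.Avoids (Sum.inl (some e)) (Sum.inl (some v)) (Sum.inl (some x)) := by
  induction hn : ρ.depth v using Nat.strong_induction_on generalizing v with
  | _ n ih =>
    obtain ⟨p, hp⟩ := exists_isParent h
    have hve : some v ≠ some e := by simpa using h.ne.symm
    by_cases hpe : e = p
    · subst hpe
      exact ⟨v, hp, h, Avoids.refl fun h => hve (Sum.inl.inj h)⟩
    · have hep := hp.2 e h hpe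
      obtain ⟨x, hx, hxp, hpx⟩ := ih _ (hn ▸ hp.1.depth_lt) hep rfl
      refine ⟨x, hx, ρ.trans hxp (ρ.rel_of_anc hep hp.1), ?_⟩
      exact (avoids_of_mem (A := ρ.toTree) (ρ.muteAbove_mem v) (mem_muteAbove_self v)
        (Or.inl (show ρ.IsParentOrRoot (some p) v from hp)) hve
        (by simpa using Ne.symm hpe)).trans hpx

theorem avoids_toTree_of_rel {e v w : E} (h : ρ.rel e v w) :
    ρ.toTree.graph.Avoids (Sum.inl (some e)) (Sum.inl (some v)) (Sum.inl (some w)) := by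
  obtain ⟨x, hx, hxv, hvx⟩ := exists_avoids_toTree_child (rel_left h)
  obtain ⟨y, hy, hyw, hwy⟩ := exists_avoids_toTree_child (rel_right h)
  have hxy := siblings_of_rel hx hy (ρ.trans (ρ.trans hxv h) (ρ.symm hyw))
  refine hvx.trans ((avoids_of_mem (A := ρ.toTree) (ρ.muteAbove_mem x) (mem_muteAbove_self x)
    (Or.inr ⟨y, rfl, hxy⟩) ?_ ?_).trans hwy.symm)
  · simpa using hx.1.ne.symm
  · simpa using hy.1.ne.symm

open Classical in
/-- The branch at `e` is constant along the walks that avoid `e`. -/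
theorem rel_iff_of_avoids_toTree {e v : E} {y : Option E}
    (h : ρ.toTree.graph.Avoids (Sum.inl (some e)) (Sum.inl (some v)) (Sum.inl y)) (u : E) :
    ρ.rel e v u ↔ ∃ w, y = some w ∧ ρ.rel e w u := by
  let f : Option E ⊕ ρ.toTree.mutes → Prop
    | Sum.inl y => ∃ w, y = some w ∧ ρ.rel e w u
    | Sum.inr m => ∃ w, m.1 = ρ.muteAbove w ∧ ρ.rel e w u
  have key : ∀ (x : Option E) (m : ρ.toTree.mutes), x ∈ m.1 → x ≠ some e →
      (f (Sum.inl x) ↔ f (Sum.inr m)) := by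
    rintro x ⟨_, v, rfl⟩ hx hxe
    have h1 : f (Sum.inr ⟨_, v, rfl⟩) ↔ ρ.rel e v u :=
      ⟨fun ⟨w, hw, hwu⟩ => (muteAbove_eq_iff.1 hw e u).2 hwu, fun h => ⟨v, rfl, h⟩⟩
    rw [h1]
    rcases hx with hx | ⟨w, rfl, hw⟩
    · rcases x with _ | p
      · refine ⟨?_, fun h => absurd (rel_left h) (hx e)⟩
        rintro ⟨_, h, -⟩
        cases h
      · have hp : ρ.IsParent p v := hx
        have hpe : e ≠ p := fun h => hxe (h ▸ rfl)
        constructor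
        · rintro ⟨w, hw, hwu⟩
          obtain rfl := Option.some.inj hw
          exact ρ.trans (ρ.symm (ρ.rel_of_anc (rel_left hwu) hp.1)) hwu
        · intro hvu
          exact ⟨p, rfl, ρ.trans (ρ.rel_of_anc (hp.2 e (rel_left hvu) hpe) hp.1) hvu⟩
    · refine ⟨?_, fun h => ⟨w, rfl, (hw e u).1 h⟩⟩
      rintro ⟨w', hw', hwu⟩
      obtain rfl := Option.some.inj hw'
      exact (hw e u).2 hwu
  have h2 : f (Sum.inl (some v)) = f (Sum.inl y) := by
    refine h.apply_eq f ?_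
    rintro (x | m) (y | n) hadj hx hy
    · exact hadj.elim
    · exact propext (key x n hadj fun h => hx (congrArg Sum.inl h))
    · exact propext (key y m hadj fun h => hy (congrArg Sum.inl h)).symm
    · exact hadj.elim
  refine Iff.trans ⟨fun h => ⟨v, rfl, h⟩, ?_⟩ (iff_of_eq h2)
  rintro ⟨w, hw, h⟩
  obtain rfl := Option.some.inj hw
  exact h

@[simp]
theorem nesting_toTree_rel {e v w : E} : ρ.toTree.nesting.rel e v w ↔ ρ.rel e v w := by
  constructor
  · rintro ⟨h, h'⟩
    have hv : ρ.Anc e v := by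
      by_contra hv
      exact h' (avoids_toTree_root (fun h0 => h.ne_left (by rw [h0])) hv)
    obtain ⟨w', hw', h1⟩ := (rel_iff_of_avoids_toTree h v).1 hv
    obtain rfl := Option.some.inj hw'
    exact ρ.symm h1
  · refine fun h => ⟨avoids_toTree_of_rel h, fun h' => ?_⟩
    obtain ⟨_, h1, -⟩ := (rel_iff_of_avoids_toTree h' w).1 h
    cases h1

end Nesting

namespace PlantedTree

open SimpleGraph

variable {E : Type u} [Finite E] {A A' : PlantedTree E}

/-- The folding order in terms of nestings. -/
theorem le_iff_nesting : A ≤ A' ↔ (∀ e v, A.nesting.Anc e v → A'.nesting.Anc e v) ∧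
    ∀ e v w, A'.nesting.rel e v w → A.nesting.Anc e v → A.nesting.rel e v w := by
  constructor
  · intro h
    have h1 : ∀ {e : E} {x y : Option E}, x ≠ some e → y ≠ some e →
        A'.graph.Avoids (Sum.inl (some e)) (Sum.inl x) (Sum.inl y) →
          A.graph.Avoids (Sum.inl (some e)) (Sum.inl x) (Sum.inl y) := fun {e x y} hx hy hxy =>
      A.branchSetoid_iff.1 (branchSetoid_le h e ((A'.branchSetoid_iff (x := ⟨x, hx⟩)
        (y := ⟨y, hy⟩)).2 hxy))
    refine ⟨fun e v hv => ?_, fun e v w hvw hv => ⟨?_, hv.2⟩⟩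
    · rw [nesting_anc_iff] at hv ⊢
      exact ⟨hv.1, fun h' => hv.2 (h1 (by simpa using hv.1) (by simp) h')⟩
    · exact h1 (fun h => hvw.1.ne_left (congrArg Sum.inl h))
        (fun h => hvw.1.ne_right (congrArg Sum.inl h)) hvw.1
  · rintro ⟨h1, h2⟩
    rw [le_iff_branchSetoid_le]
    rintro e ⟨x, hx⟩ ⟨y, hy⟩ hxy
    rw [branchSetoid_iff] at hxy ⊢
    have key : ∀ v, v ≠ e → ¬ A'.nesting.Anc e v →
        A.graph.Avoids (Sum.inl (some e)) (Sum.inl (some v)) (Sum.inl none) := by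
      intro v hv hv'
      by_contra h
      exact hv' (h1 e v (nesting_anc_iff.2 ⟨hv, h⟩))
    have key' : ∀ v, v ≠ e → ¬ A.nesting.Anc e v →
        A.graph.Avoids (Sum.inl (some e)) (Sum.inl (some v)) (Sum.inl none) := by
      intro v hv hv'
      by_contra h
      exact hv' (nesting_anc_iff.2 ⟨hv, h⟩)
    rcases x with _ | v <;> rcases y with _ | w
    · exact Avoids.refl (by simp)
    · exact (key w (by simpa using hy) fun h => h.2 hxy.symm).symm
    · exact key v (by simpa using hx) fun h => h.2 hxy
    · have hv : v ≠ e := by simpa using hx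
      have hw : w ≠ e := by simpa using hy
      by_cases h3 : A.nesting.Anc e v
      · exact (h2 e v w ⟨hxy, (h1 e v h3).2⟩ h3).1
      · by_cases h4 : A.nesting.Anc e w
        · exact (h2 e w v ⟨hxy.symm, (h1 e w h4).2⟩ h4).1.symm
        · exact (key' v hv h3).trans (key' w hw h4).symm

theorem eq_of_nesting_rel_iff (h : ∀ e v w, A.nesting.rel e v w ↔ A'.nesting.rel e v w) :
    A = A' :=
  le_antisymm (le_iff_nesting.2 ⟨fun e v => (h e v v).1, fun e v w hvw _ => (h e v w).2 hvw⟩)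
    (le_iff_nesting.2 ⟨fun e v => (h e v v).2, fun e v w hvw _ => (h e v w).1 hvw⟩)

theorem toTree_nesting [Nonempty E] (A : PlantedTree E) : A.nesting.toTree = A :=
  eq_of_nesting_rel_iff fun _ _ _ => Nesting.nesting_toTree_rel

/-- In a tree of `bivalentTrees E`, a mute vertex below a labelled vertex `S_p` has only one other
neighbour, so that two siblings which are not attached to the mute vertex of the root are equal. -/
theorem eq_of_siblings (hA : A ∈ bivalentTrees E) {e v w : E} (hv : A.nesting.Anc e v)
    (hvw : A.nesting.siblings v w) : v = w := by
  by_contra hne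
  have := A.nonempty_label
  obtain ⟨p, hp⟩ := Nesting.exists_isParent hv
  have hm : A.nesting.muteAbove v ∈ A.mutes := by
    have h : A.nesting.mutes = A.mutes := congrArg mutes A.toTree_nesting
    exact h ▸ A.nesting.muteAbove_mem v
  have h0 : none ∉ A.nesting.muteAbove v := by
    rintro (h | ⟨_, h, -⟩)
    · exact h e hv
    · cases h
  have h1 : ({some p, some v, some w} : Set (Option E)) ⊆ A.nesting.muteAbove v := by
    rintro x (rfl | rfl | rfl)
    · exact Or.inl hp
    · exact Nesting.mem_muteAbove_self v
    · exact Or.inr ⟨w, rfl, hvw⟩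
  have h2 := Set.ncard_le_ncard h1 (Set.toFinite _)
  rw [hA _ hm h0, Set.ncard_eq_three.2 ⟨some p, some v, some w, by simpa using hp.1.ne,
    by simpa using ((Nesting.siblings_isParent hvw).1 hp).1.ne, by simpa using hne, rfl⟩] at h2
  omega

end PlantedTree

theorem Nesting.toTree_mem_bivalentTrees {E : Type u} [Finite E] [Nonempty E] {ρ : Nesting E}
    (h : ∀ e v w, ρ.Anc e v → ρ.siblings v w → v = w) :
    ρ.toTree ∈ PlantedTree.bivalentTrees E := by
  rintro _ ⟨v, rfl⟩ h0
  obtain ⟨x, hx⟩ := ρ.exists_isParentOrRoot v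
  rcases x with _ | p
  · exact absurd (Or.inl hx) h0
  have : ρ.muteAbove v = {some p, some v} := by
    ext y
    constructor
    · rintro (hy | ⟨w, rfl, hw⟩)
      · exact Or.inl (Nesting.isParentOrRoot_unique hy hx)
      · exact Or.inr (congrArg some (h p v w hx.1 hw).symm)
    · rintro (rfl | rfl)
      · exact Or.inl hx
      · exact Nesting.mem_muteAbove_self v
  rw [this]
  exact Set.ncard_pair (by simpa using hx.1.ne)

/-! ### Folding and unfolding -/

namespace Nesting

variable {E : Type u} {ρ ρ' : Nesting E} {a b e v w x : E}

variable (ρ) in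
/-- The nesting obtained by discarding the branches that are not contained in `U`. On planted trees,
this amounts to folding the branches `v` at `e` such that `¬ U e v` onto the parent of `e`. -/
def restrict (U : E → E → Prop) : Nesting E where
  rel e v w := ρ.rel e v w ∧ ∀ x, ρ.rel e v x → U e x
  symm h := ⟨ρ.symm h.1, fun x hx => h.2 x (ρ.trans h.1 hx)⟩
  trans h h' := ⟨ρ.trans h.1 h'.1, h.2⟩
  irrefl e h := ρ.irrefl e h.1
  rel_of_anc h h' := ⟨ρ.rel_of_anc h.1 h'.1, h.2⟩
  chain h h' hab := (ρ.chain h.1 h'.1 hab).imp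
    (fun hb => ⟨hb, fun x hx => h.2 x (ρ.trans (ρ.symm (ρ.rel_of_anc hb h'.1)) hx)⟩)
    (fun ha => ⟨ha, fun x hx => h'.2 x (ρ.trans (ρ.symm (ρ.rel_of_anc ha h.1)) hx)⟩)

theorem restrict_rel {U : E → E → Prop} :
    (ρ.restrict U).rel e v w ↔ ρ.rel e v w ∧ (ρ.restrict U).Anc e v :=
  ⟨fun h => ⟨h.1, rel_left h⟩, fun h => ⟨h.1, h.2.2⟩⟩

theorem restrict_anc {U : E → E → Prop} (hU : ∀ e v w, ρ.rel e v w → U e v → U e w)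
    (hU' : ∀ e v, U e v → ρ.Anc e v) : (ρ.restrict U).Anc e v ↔ U e v :=
  ⟨fun h => h.2 v h.1, fun h => ⟨hU' e v h, fun x hx => hU e v x hx h⟩⟩

theorem eq_or_anc_trans (h : a = b ∨ ρ.Anc a b) (h' : b = v ∨ ρ.Anc b v) : a = v ∨ ρ.Anc a v := by
  rcases h with rfl | h
  · exact h'
  · rcases h' with rfl | h'
    · exact Or.inr h
    · exact Or.inr (h.trans h')

theorem anc_of_eq_or_anc (h : ρ.Anc a b) (h' : b = v ∨ ρ.Anc b v) : ρ.Anc a v := by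
  rcases h' with rfl | h'
  · exact h
  · exact h.trans h'

theorem eq_or_anc_total (h : a = v ∨ ρ.Anc a v) (h' : b = v ∨ ρ.Anc b v) :
    (a = b ∨ ρ.Anc a b) ∨ (b = a ∨ ρ.Anc b a) := by
  rcases h with rfl | h
  · exact Or.inr h'
  rcases h' with rfl | h'
  · exact Or.inl (Or.inr h)
  by_cases hab : a = b
  · exact Or.inl (Or.inl hab)
  · exact (ρ.chain h h' hab).imp Or.inr Or.inr

variable (ρ) in
/-- The finest nesting with the same ancestors. On planted trees, this amounts to unfolding all the
mute vertices below the labelled vertices, so that they become bivalent. -/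
def split : Nesting E where
  rel e v w := ∃ x, ρ.Anc e x ∧ (x = v ∨ ρ.Anc x v) ∧ (x = w ∨ ρ.Anc x w)
  symm := fun ⟨x, hx, hv, hw⟩ => ⟨x, hx, hw, hv⟩
  trans := fun ⟨x, hx, hv, hw⟩ ⟨y, hy, hw', hu⟩ => by
    rcases eq_or_anc_total hw hw' with h | h
    · exact ⟨x, hx, hv, eq_or_anc_trans h hu⟩
    · exact ⟨y, hy, eq_or_anc_trans h hv, hu⟩
  irrefl e := fun ⟨x, hx, h, _⟩ => ρ.irrefl e (anc_of_eq_or_anc hx h)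
  rel_of_anc := fun {e v w} ⟨x, hx, hv, _⟩ ⟨y, hy, hw, _⟩ =>
    ⟨v, anc_of_eq_or_anc hx hv, Or.inl rfl, Or.inr (anc_of_eq_or_anc hy hw)⟩
  chain := fun {a b v} ⟨x, hx, hv, _⟩ ⟨y, hy, hw, _⟩ hab =>
    (ρ.chain (anc_of_eq_or_anc hx hv) (anc_of_eq_or_anc hy hw) hab).imp
      (fun h => ⟨b, h, Or.inl rfl, Or.inl rfl⟩) (fun h => ⟨a, h, Or.inl rfl, Or.inl rfl⟩)

theorem rel_of_split_rel (h : ρ.split.rel e v w) : ρ.rel e v w := by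
  obtain ⟨x, hx, hv, hw⟩ := h
  exact ρ.trans (ρ.symm (rel_of_eq_or_anc hx hv)) (rel_of_eq_or_anc hx hw)

@[simp]
theorem split_anc : ρ.split.Anc e v ↔ ρ.Anc e v :=
  ⟨rel_of_split_rel, fun h => ⟨v, h, Or.inl rfl, Or.inl rfl⟩⟩

@[simp]
theorem split_isParent : ρ.split.IsParent e v ↔ ρ.IsParent e v := by
  simp only [IsParent, split_anc]

theorem eq_of_split_siblings [Finite E] (h : ρ.Anc e v) (hvw : ρ.split.siblings v w) : v = w := by
  obtain ⟨p, hp⟩ := exists_isParent h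
  have hp' : ρ.IsParent p w := split_isParent.1 ((siblings_isParent hvw).1 (split_isParent.2 hp))
  obtain ⟨x, hx, hxw, hxv⟩ := (hvw p v).1 (split_anc.2 hp.1)
  have key : ∀ {u}, ρ.IsParent p u → (x = u ∨ ρ.Anc x u) → x = u := by
    rintro u hu (h | h)
    · exact h
    · exact absurd (hu.2 x h hx.ne.symm) hx.not_anc
  exact (key hp hxv).symm.trans (key hp' hxw)

/-- A nesting is bivalent if there is only one child in each branch. -/
def Bivalent (ρ : Nesting E) : Prop :=
  ∀ e v w, ρ.Anc e v → ρ.siblings v w → v = w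

theorem bivalent_split [Finite E] : ρ.split.Bivalent :=
  fun _ _ _ h h' => eq_of_split_siblings (split_anc.1 h) h'

theorem Bivalent.eq (h : ρ.Bivalent) (hv : ρ.IsParent e v) (hw : ρ.IsParent e w)
    (hvw : ρ.rel e v w) : v = w :=
  h e v w hv.1 (siblings_of_rel hv hw hvw)

/-- A bivalent nesting is determined by the parents. -/
theorem Bivalent.rel_of_isParent [Finite E] (hρ : ρ.Bivalent)
    (h : ∀ e v, ρ.IsParent e v → ρ'.IsParent e v) (hvw : ρ.rel e v w) : ρ'.rel e v w := by
  have hanc : ∀ {e v}, ρ.Anc e v → ρ'.Anc e v := by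
    intro e v hv
    induction hn : ρ.depth v using Nat.strong_induction_on generalizing v with
    | _ n ih =>
      obtain ⟨p, hp⟩ := exists_isParent hv
      by_cases hep : e = p
      · exact hep ▸ (h p v hp).1
      · exact (ih _ (hn ▸ hp.1.depth_lt) (hp.2 e hv hep) rfl).trans (h p v hp).1
  obtain ⟨x, hx, hxv⟩ := exists_child (rel_left hvw)
  obtain ⟨y, hy, hyw⟩ := exists_child (rel_right hvw)
  obtain rfl : x = y := hρ.eq hx hy (ρ.trans (ρ.trans (rel_of_eq_or_anc hx.1 hxv) hvw)
    (ρ.symm (rel_of_eq_or_anc hy.1 hyw)))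
  exact ρ'.trans (ρ'.symm (rel_of_eq_or_anc (h e x hx).1 (hxv.imp id hanc)))
    (rel_of_eq_or_anc (h e x hx).1 (hyw.imp id hanc))

open Classical in
/-- If the parent of `v` for `ρ'` is an ancestor of `v` for `ρ`, and each branch of `ρ` at `e`
contains a child of `e` for `ρ'`, then `ρ` and `ρ'` have the same parents. Indeed, if `v` has parent
`e` for `ρ'`, let `q v` be the child of `e` for `ρ` above `v`. This is a surjective self-map of a
finite set which does not increase the depth, so it preserves the depth, and `q v = v`. -/
theorem Bivalent.isParent_iff_of_surjective [Finite E] (hρ : ρ.Bivalent)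
    (htot : ∀ e v, ρ'.IsParent e v → ρ.Anc e v)
    (hsurj : ∀ e x, ρ.Anc e x → ∃ v, ρ'.IsParent e v ∧ ρ.rel e v x) :
    ρ.IsParent e v ↔ ρ'.IsParent e v := by
  have := Fintype.ofFinite E
  let N : Finset E := {v | ∃ e, ρ.IsParent e v}
  let N' : Finset E := {v | ∃ e, ρ'.IsParent e v}
  have hN : ∀ {v}, v ∈ N ↔ ∃ e, ρ.IsParent e v := by simp [N]
  have hN' : ∀ {v}, v ∈ N' ↔ ∃ e, ρ'.IsParent e v := by simp [N']
  have hq : ∀ v, ∃ x, ∀ e, ρ'.IsParent e v → ρ.IsParent e x ∧ (x = v ∨ ρ.Anc x v) := by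
    intro v
    by_cases hv : ∃ e, ρ'.IsParent e v
    · obtain ⟨e, he⟩ := hv
      obtain ⟨x, hx⟩ := exists_child (htot e v he)
      exact ⟨x, fun e' he' => he.unique he' ▸ hx⟩
    · exact ⟨v, fun e he => absurd ⟨e, he⟩ hv⟩
  choose q hq using hq
  have hsub : N' ⊆ N := fun v hv => by
    obtain ⟨e, he⟩ := hN'.1 hv
    exact hN.2 (exists_isParent (htot e v he))
  have himg : N ⊆ N'.image q := fun x hx => by
    obtain ⟨e, he⟩ := hN.1 hx
    obtain ⟨v, hv, hvx⟩ := hsurj e x he.1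
    obtain ⟨h1, h2⟩ := hq v e hv
    exact Finset.mem_image.2 ⟨v, hN'.2 ⟨e, hv⟩,
      hρ.eq h1 he (ρ.trans (rel_of_eq_or_anc h1.1 h2) hvx)⟩
  have hcard : N' = N := Finset.eq_of_subset_of_card_le hsub
    ((Finset.card_le_card himg).trans Finset.card_image_le)
  have himg' : N'.image q = N := by
    refine (Finset.eq_of_subset_of_card_le himg ?_).symm
    rw [← hcard]
    exact Finset.card_image_le
  have hinj : Set.InjOn q N' := by
    rw [← Finset.card_image_iff, himg', hcard]
  have hle : ∀ v ∈ N', ρ.depth (q v) ≤ ρ.depth v := fun v hv => by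
    obtain ⟨e, he⟩ := hN'.1 hv
    rcases (hq v e he).2 with h | h
    · rw [h]
    · exact h.depth_lt.le
  have hsum : ∑ v ∈ N', ρ.depth (q v) = ∑ v ∈ N', ρ.depth v := by
    rw [← Finset.sum_image (f := ρ.depth) hinj, himg', hcard]
  have heq := (Finset.sum_eq_sum_iff_of_le hle).1 hsum
  have key : ∀ {e v}, ρ'.IsParent e v → ρ.IsParent e v := by
    intro e v he
    obtain ⟨h1, h2 | h2⟩ := hq v e he
    · rwa [h2] at h1
    · exact absurd (heq v (hN'.2 ⟨e, he⟩)) h2.depth_lt.ne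
  refine ⟨fun h => ?_, key⟩
  have hv : v ∈ N' := hcard ▸ hN.2 ⟨e, h⟩
  obtain ⟨e', he'⟩ := hN'.1 hv
  exact h.unique (key he') ▸ he'

end Nesting

namespace PlantedTree

open Nesting

variable {E : Type u} [Finite E]

theorem bivalent_nesting {A : PlantedTree E} (hA : A ∈ bivalentTrees E) : A.nesting.Bivalent :=
  fun _ _ _ hv hvw => eq_of_siblings hA hv hvw

/-- The tree obtained from `A` by folding onto the parent of `e` the branches at `e` that are not
contained in `U e`. -/
def fold (A : PlantedTree E) (U : E → E → Prop) : PlantedTree E :=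
  have := A.nonempty_label
  (A.nesting.restrict U).toTree

theorem fold_rel {A : PlantedTree E} {U : E → E → Prop} {e v w : E} :
    (A.fold U).nesting.rel e v w ↔ (A.nesting.restrict U).rel e v w :=
  have := A.nonempty_label
  nesting_toTree_rel

theorem fold_le (A : PlantedTree E) (U : E → E → Prop) : A.fold U ≤ A := by
  refine le_iff_nesting.2 ⟨fun e v h => (fold_rel.1 h).1, fun e v w h h' => ?_⟩
  exact fold_rel.2 (restrict_rel.2 ⟨h, fold_rel.1 h'⟩)

/-- The tree obtained from `A` by unfolding all the mute vertices below the labelled vertices. -/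
def unfold (A : PlantedTree E) : PlantedTree E :=
  have := A.nonempty_label
  A.nesting.split.toTree

theorem unfold_rel {A : PlantedTree E} {e v w : E} :
    A.unfold.nesting.rel e v w ↔ A.nesting.split.rel e v w :=
  have := A.nonempty_label
  nesting_toTree_rel

theorem unfold_anc {A : PlantedTree E} {e v : E} : A.unfold.nesting.Anc e v ↔ A.nesting.Anc e v :=
  unfold_rel.trans split_anc

theorem le_unfold (A : PlantedTree E) : A ≤ A.unfold :=
  le_iff_nesting.2 ⟨fun _ _ => unfold_anc.2, fun _ _ _ h _ => rel_of_split_rel (unfold_rel.1 h)⟩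

theorem unfold_mem_bivalentTrees (A : PlantedTree E) : A.unfold ∈ bivalentTrees E :=
  have := A.nonempty_label
  toTree_mem_bivalentTrees bivalent_split

end PlantedTree

/-! ### The branches as retracts of the set of labels -/

section PartialFunctions

variable {E : Type u} {X Y Z : E → FinPartialFun.{u}}

theorem FinPartialFun.hom_ext {f g : X ⟶ Y}
    (h : ∀ e x y, y ∈ (f e).toPFun x ↔ y ∈ (g e).toPFun x) : f = g :=
  funext fun e => FinPartialFun.Hom.ext (PFun.ext (h e))

theorem FinPartialFun.mem_comp {f : X ⟶ Y} {g : Y ⟶ Z} {e : E} {x : (X e).carrier}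
    {z : (Z e).carrier} :
    z ∈ ((f ≫ g) e).toPFun x ↔ ∃ y ∈ (f e).toPFun x, z ∈ (g e).toPFun y :=
  Part.mem_bind_iff

theorem FinPartialFun.mem_id {e : E} {x y : (X e).carrier} :
    y ∈ ((𝟙 X : X ⟶ X) e).toPFun x ↔ y = x :=
  Part.mem_some_iff

theorem FinPartialFun.mem_familyIdem {M : ∀ e, Set (X e).carrier} {e : E}
    {x y : (X e).carrier} : y ∈ (familyIdem X M e).toPFun x ↔ x ∈ M e ∧ y = x := by
  refine (PFun.mem_restrict _ _ _).trans (and_congr_right fun _ => ?_)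
  exact Part.mem_some_iff

theorem familyIdem_comp (M N : ∀ e, Set (X e).carrier) :
    familyIdem X M ≫ familyIdem X N = familyIdem X (M ⊓ N) := by
  refine FinPartialFun.hom_ext fun e x y => ?_
  simp only [FinPartialFun.mem_comp, FinPartialFun.mem_familyIdem]
  constructor
  · rintro ⟨_, ⟨h, rfl⟩, h', rfl⟩
    exact ⟨⟨h, h'⟩, rfl⟩
  · rintro ⟨⟨h, h'⟩, rfl⟩
    exact ⟨_, ⟨h, rfl⟩, h', rfl⟩

theorem familyIdem_top : familyIdem X ⊤ = 𝟙 X := by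
  refine FinPartialFun.hom_ext fun e x y => ?_
  rw [FinPartialFun.mem_familyIdem, FinPartialFun.mem_id]
  exact and_iff_right trivial

/-- A partial function is unchanged when restricted to its domain. -/
theorem familyIdem_dom_comp (f : X ⟶ Y) :
    familyIdem X (fun e => {x | ((f e).toPFun x).Dom}) ≫ f = f := by
  refine FinPartialFun.hom_ext fun e x y => ?_
  simp only [FinPartialFun.mem_comp, FinPartialFun.mem_familyIdem]
  constructor
  · rintro ⟨_, ⟨-, rfl⟩, h⟩
    exact h
  · exact fun h => ⟨x, ⟨Part.dom_iff_mem.2 ⟨y, h⟩, rfl⟩, h⟩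

/-- A partial function is unchanged when composed with the idempotent attached to its range. -/
theorem comp_familyIdem_range (f : X ⟶ Y) :
    f ≫ familyIdem Y (fun e => {y | ∃ x, y ∈ (f e).toPFun x}) = f := by
  refine FinPartialFun.hom_ext fun e x y => ?_
  simp only [FinPartialFun.mem_comp, FinPartialFun.mem_familyIdem]
  constructor
  · rintro ⟨_, h, -, rfl⟩
    exact h
  · exact fun h => ⟨y, h, ⟨x, h⟩, rfl⟩

end PartialFunctions

namespace PlantedTree

open SimpleGraph Nesting

variable {E : Type u} {A A' : PlantedTree E} {e v w : E}

/-- The branch at `e` that contains a given descendant of `e`. -/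
def mkBranch (h : A.nesting.Anc e v) : A.Branch e :=
  ⟨Quotient.mk _ ⟨some v, fun h' => h.ne (Option.some.inj h').symm⟩,
    fun h' => h.2 (A.branchSetoid_iff.1 (Quotient.exact h'))⟩

theorem mkBranch_eq_iff {h : A.nesting.Anc e v} {h' : A.nesting.Anc e w} :
    mkBranch h = mkBranch h' ↔ A.nesting.rel e v w :=
  ⟨fun h0 => ⟨A.branchSetoid_iff.1 (Quotient.exact (congrArg Subtype.val h0)), h.2⟩,
    fun h0 => Subtype.ext (Quotient.sound (A.branchSetoid_iff.2 h0.1))⟩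

theorem exists_mkBranch (c : A.Branch e) : ∃ (v : E) (h : A.nesting.Anc e v), mkBranch h = c := by
  obtain ⟨c, hc⟩ := c
  induction c using Quotient.inductionOn with
  | _ x =>
    obtain ⟨_ | v, hx⟩ := x
    · exact absurd rfl hc
    · refine ⟨v, nesting_anc_iff.2 ⟨fun h => hx (congrArg some h), fun h => hc ?_⟩, rfl⟩
      exact Quotient.sound (A.branchSetoid_iff.2 h)

/-- Each branch at `e` contains a child of `e`. -/
theorem exists_isParent_mkBranch [Finite E] (c : A.Branch e) :
    ∃ (v : E) (h : A.nesting.IsParent e v), mkBranch h.1 = c := by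
  obtain ⟨v, h, rfl⟩ := exists_mkBranch c
  obtain ⟨x, hx, hxv⟩ := exists_child h
  exact ⟨x, hx, mkBranch_eq_iff.2 (rel_of_eq_or_anc hx.1 hxv)⟩

theorem mem_branchMap_mkBranch [Finite E] (h : A ≤ A') (hv : A'.nesting.Anc e v) {c : A.Branch e} :
    c ∈ branchMap h e (mkBranch hv) ↔ ∃ hv' : A.nesting.Anc e v, mkBranch hv' = c := by
  constructor
  · rintro ⟨h1, rfl⟩
    refine ⟨nesting_anc_iff.2 ⟨hv.ne.symm, fun h2 => h1 ?_⟩, rfl⟩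
    exact Quotient.sound (A.branchSetoid_iff.2 h2)
  · rintro ⟨hv', rfl⟩
    exact ⟨(mkBranch hv').2, rfl⟩

/-- The constant family with value the set of labels. -/
abbrev labels (E : Type u) [Finite E] : E → FinPartialFun.{u} := fun _ => FinPartialFun.of E

variable [Finite E]

/-- The family of the sets of branches of a tree. -/
abbrev branches (A : PlantedTree E) : E → FinPartialFun.{u} := ((branchFunctor E).obj A).unop

/-- The partial functions `f_e^{A,A'}`, as a morphism. -/
abbrev mapBranches (h : A ≤ A') : A'.branches ⟶ A.branches :=
  ((branchFunctor E).map (homOfLE h)).unop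

/-- The morphism whose component at `e` sends each descendant of `e` to its branch. -/
def toBranches (A : PlantedTree E) : labels E ⟶ A.branches := fun e =>
  FinPartialFun.ofPFun fun v => ⟨A.nesting.Anc e v, fun h => mkBranch h⟩

/-- A section of `A.toBranches`, which sends each branch at `e` to a child of `e`. -/
noncomputable def ofBranches (A : PlantedTree E) : A.branches ⟶ labels E := fun e =>
  FinPartialFun.ofPFun fun c : A.Branch e => Part.some (exists_isParent_mkBranch c).choose

theorem exists_of_mem_ofBranches {c : A.Branch e} (h : v ∈ (A.ofBranches e).toPFun c) :
    ∃ h : A.nesting.IsParent e v, mkBranch h.1 = c := by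
  obtain rfl := Part.mem_some_iff.1 h
  exact (exists_isParent_mkBranch c).choose_spec

theorem exists_mem_ofBranches (c : A.Branch e) : ∃ v : E, v ∈ (A.ofBranches e).toPFun c :=
  ⟨_, Part.mem_some _⟩

theorem ofBranches_toBranches (A : PlantedTree E) : A.ofBranches ≫ A.toBranches = 𝟙 _ := by
  refine FinPartialFun.hom_ext fun e c d => ?_
  rw [FinPartialFun.mem_comp, FinPartialFun.mem_id]
  constructor
  · rintro ⟨v, hv, h, rfl⟩
    obtain ⟨h', rfl⟩ := exists_of_mem_ofBranches hv
    rfl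
  · rintro rfl
    obtain ⟨v, hv⟩ := exists_mem_ofBranches d
    obtain ⟨h', h''⟩ := exists_of_mem_ofBranches hv
    exact ⟨v, hv, h'.1, h''⟩

theorem toBranches_mapBranches (h : A ≤ A') : A'.toBranches ≫ mapBranches h = A.toBranches := by
  refine FinPartialFun.hom_ext fun e v c => ?_
  rw [FinPartialFun.mem_comp]
  constructor
  · rintro ⟨_, ⟨hv, rfl⟩, hc⟩
    exact (mem_branchMap_mkBranch h hv).1 hc
  · rintro ⟨hv, rfl⟩
    have hv' := (le_iff_nesting.1 h).1 e v hv
    exact ⟨mkBranch hv', ⟨hv', rfl⟩, (mem_branchMap_mkBranch h hv').2 ⟨hv, rfl⟩⟩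

theorem toBranches_apply_eq (h : A.nesting.rel e v w) :
    (A.toBranches e).toPFun v = (A.toBranches e).toPFun w := by
  refine Part.ext fun c => ⟨?_, ?_⟩
  · rintro ⟨hv, rfl⟩
    exact ⟨rel_right h, (mkBranch_eq_iff (h := rel_right h) (h' := hv)).2 (A.nesting.symm h)⟩
  · rintro ⟨hw, rfl⟩
    exact ⟨rel_left h, (mkBranch_eq_iff (h := rel_left h) (h' := hw)).2 h⟩

/-- A morphism `g` factors through `A.toBranches` if and only if its domain consists of descendants
and it is constant on the branches. -/
theorem toBranches_ofBranches_comp_eq_iff {Z : E → FinPartialFun.{u}} {g : labels E ⟶ Z} :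
    A.toBranches ≫ A.ofBranches ≫ g = g ↔
      (∀ e v, ((g e).toPFun v).Dom → A.nesting.Anc e v) ∧
        ∀ e v w, A.nesting.rel e v w → (g e).toPFun v = (g e).toPFun w := by
  constructor
  · intro h
    rw [← h]
    refine ⟨fun e v hv => ?_, fun e v w hvw => ?_⟩
    · obtain ⟨z, hz⟩ := Part.dom_iff_mem.1 hv
      obtain ⟨c, ⟨hv, -⟩, -⟩ := FinPartialFun.mem_comp.1 hz
      exact hv
    · exact congrArg (fun c => Part.bind c _) (toBranches_apply_eq hvw)
  · rintro ⟨h1, h2⟩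
    refine FinPartialFun.hom_ext fun e v z => ?_
    simp only [FinPartialFun.mem_comp]
    constructor
    · rintro ⟨_, ⟨hv, rfl⟩, w, hw, hz⟩
      obtain ⟨hw', h⟩ := exists_of_mem_ofBranches hw
      rwa [h2 e v w (A.nesting.symm ((mkBranch_eq_iff (h' := hv)).1 h))]
    · intro hz
      have hv := h1 e v (Part.dom_iff_mem.2 ⟨z, hz⟩)
      obtain ⟨w, hw⟩ := exists_mem_ofBranches (mkBranch hv)
      obtain ⟨hw', h⟩ := exists_of_mem_ofBranches hw
      refine ⟨_, ⟨hv, rfl⟩, w, hw, ?_⟩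
      rwa [← h2 e v w (A.nesting.symm (mkBranch_eq_iff.1 h))]

/-- Two trees of `bivalentTrees E` are equal if the partial function from the branches of the second
to those of the first, which sends a branch to the branch that contains its child, is defined
everywhere and surjective. -/
theorem eq_of_ofBranches_toBranches_surjective {B B' : PlantedTree E} (hB : B ∈ bivalentTrees E)
    (hB' : B' ∈ bivalentTrees E)
    (htot : ∀ e (c : B'.Branch e), (((B'.ofBranches ≫ B.toBranches) e).toPFun c).Dom)
    (hsurj : ∀ e (d : B.Branch e), ∃ c : B'.Branch e,
      d ∈ ((B'.ofBranches ≫ B.toBranches) e).toPFun c) : B = B' := by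
  have hb := bivalent_nesting hB
  have hb' := bivalent_nesting hB'
  have key : ∀ e v, B.nesting.IsParent e v ↔ B'.nesting.IsParent e v := by
    refine fun e v => hb.isParent_iff_of_surjective (fun e v h => ?_) (fun e x h => ?_)
    · obtain ⟨d, hd⟩ := Part.dom_iff_mem.1 (htot e (mkBranch h.1))
      obtain ⟨w, hw, hw', -⟩ := FinPartialFun.mem_comp.1 hd
      obtain ⟨h1, h2⟩ := exists_of_mem_ofBranches hw
      exact hb'.eq h1 h (mkBranch_eq_iff.1 h2) ▸ hw'
    · obtain ⟨c, hc⟩ := hsurj e (mkBranch h)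
      obtain ⟨w, hw, hw', h1⟩ := FinPartialFun.mem_comp.1 hc
      obtain ⟨h2, -⟩ := exists_of_mem_ofBranches hw
      exact ⟨w, h2, (mkBranch_eq_iff (h := hw')).1 h1⟩
  exact eq_of_nesting_rel_iff fun e v w => ⟨hb.rel_of_isParent fun e v => (key e v).1,
    hb'.rel_of_isParent fun e v => (key e v).2⟩

/-- The tree obtained from `A` by folding the branches that do not belong to `M`. -/
def foldCompl (A : PlantedTree E) (M : ∀ e, Set (A.Branch e)) : PlantedTree E :=
  A.fold fun e v => ∃ h : A.nesting.Anc e v, mkBranch h ∈ M e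

variable {M : ∀ e, Set (A.Branch e)}

theorem foldCompl_le (A : PlantedTree E) (M : ∀ e, Set (A.Branch e)) : A.foldCompl M ≤ A :=
  fold_le _ _

theorem foldCompl_anc :
    (A.foldCompl M).nesting.Anc e v ↔ ∃ h : A.nesting.Anc e v, mkBranch h ∈ M e :=
  fold_rel.trans (restrict_anc (fun _ _ _ h ⟨hv, hM⟩ =>
    ⟨rel_right h, (mkBranch_eq_iff (h := hv) (h' := rel_right h)).2 h ▸ hM⟩) fun _ _ h => h.1)

theorem foldCompl_rel :
    (A.foldCompl M).nesting.rel e v w ↔ A.nesting.rel e v w ∧ (A.foldCompl M).nesting.Anc e v :=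
  ⟨fun h => ⟨(fold_rel.1 h).1, rel_left h⟩,
    fun h => fold_rel.2 (restrict_rel.2 ⟨h.1, fold_rel.1 h.2⟩)⟩

/-- The idempotent attached to a family `M` of sets of branches factors through the tree obtained by
folding the branches that do not belong to `M`. -/
theorem mapBranches_foldCompl_comp (A : PlantedTree E) (M : ∀ e, Set (A.Branch e)) :
    mapBranches (A.foldCompl_le M) ≫ (A.foldCompl M).ofBranches ≫ A.toBranches =
      familyIdem A.branches M := by
  refine FinPartialFun.hom_ext fun e c d => ?_
  simp only [FinPartialFun.mem_comp]
  refine Iff.trans ?_ FinPartialFun.mem_familyIdem.symm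
  obtain ⟨v, hv, rfl⟩ := exists_mkBranch c
  constructor
  · rintro ⟨c, hc, w, hw, hw', rfl⟩
    obtain ⟨hv', rfl⟩ := (mem_branchMap_mkBranch _ hv).1 hc
    obtain ⟨h1, h2⟩ := exists_of_mem_ofBranches hw
    have h3 := (foldCompl_rel.1 (mkBranch_eq_iff.1 h2)).1
    exact ⟨(foldCompl_anc.1 hv').2, (mkBranch_eq_iff (h := rel_left h3)).2 h3⟩
  · rintro ⟨hM, rfl⟩
    have hv' : (A.foldCompl M).nesting.Anc e v := foldCompl_anc.2 ⟨hv, hM⟩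
    obtain ⟨w, hw⟩ := exists_mem_ofBranches (mkBranch hv')
    obtain ⟨h1, h2⟩ := exists_of_mem_ofBranches hw
    have h3 := (foldCompl_rel.1 (mkBranch_eq_iff.1 h2)).1
    exact ⟨_, (mem_branchMap_mkBranch _ hv).2 ⟨hv', rfl⟩, w, hw, rel_left h3,
      (mkBranch_eq_iff (h := rel_left h3)).2 h3⟩

/-- The number of pairs formed by a vertex and one of its descendants. -/
noncomputable def ancCard (A : PlantedTree E) : ℕ := {p : E × E | A.nesting.Anc p.1 p.2}.ncard

theorem ancCard_foldCompl_lt (hM : M < ⊤) : (A.foldCompl M).ancCard < A.ancCard := by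
  refine Set.ncard_lt_ncard ⟨fun p hp => (foldCompl_anc.1 hp).1, fun h => hM.ne ?_⟩ (Set.toFinite _)
  refine funext fun e => Set.eq_univ_of_forall fun c => ?_
  obtain ⟨v, hv, rfl⟩ := exists_mkBranch c
  exact (foldCompl_anc.1 (h (show (e, v) ∈ {p : E × E | A.nesting.Anc p.1 p.2} from hv))).2

theorem ancCard_unfold (A : PlantedTree E) : A.unfold.ancCard = A.ancCard := by
  unfold ancCard
  simp only [unfold_anc]

end PlantedTree

/-! ### The projection onto the cross effect -/

section CrossEffectProjection

/-- Given finitely many commuting idempotents `d i` of a ring, the product `ε` of the `1 - d i`,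
together with an expression of `1 - ε` in terms of the `d i`. -/
theorem exists_mul_eq_zero_of_commute_idempotent {R ι : Type*} [Ring R] (d : ι → R)
    (hcomm : ∀ i j, Commute (d i) (d j)) (hd : ∀ i, d i * d i = d i) (s : Finset ι) :
    ∃ (ε : R) (c : ι → R), (∀ i ∈ s, ε * d i = 0) ∧ (∀ j, Commute ε (d j)) ∧
      (∀ i j, Commute (c i) (d j)) ∧ 1 - ε = ∑ i ∈ s, c i * d i := by
  classical
  induction s using Finset.induction_on with
  | empty => exact ⟨1, fun _ => 0, by simp, fun _ => Commute.one_left _,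
      fun _ _ => Commute.zero_left _, by simp⟩
  | insert j s hj ih =>
    obtain ⟨ε, c, h1, h2, h3, h4⟩ := ih
    have h5 : ∀ i, Commute (1 - d j) (d i) := fun i => (Commute.one_left _).sub_left (hcomm j i)
    refine ⟨ε * (1 - d j), Function.update c j ε, fun i hi => ?_,
      fun i => (h2 i).mul_left (h5 i), fun i k => ?_, ?_⟩
    · rw [mul_assoc, (h5 i).eq, ← mul_assoc]
      obtain rfl | hi := Finset.mem_insert.1 hi
      · rw [mul_assoc, mul_sub, mul_one, hd, sub_self, mul_zero]
      · rw [h1 i hi, zero_mul]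
    · by_cases hi : i = j
      · subst hi
        simpa using h2 k
      · simpa [hi] using h3 i k
    · rw [Finset.sum_insert hj, Function.update_self,
        Finset.sum_congr rfl (g := fun i => c i * d i), ← h4]
      · noncomm_ring
      · intro i hi
        rw [Function.update_of_ne (ne_of_mem_of_not_mem hi hj)]

variable {E : Type u} (Y : E → FinPartialFun.{u})
  (T : (E → FinPartialFun.{u})ᵒᵖ ⥤ Ab.{u})

/-- The inclusion of `cr_Y(T)` in `T(Y)`. -/
def crossEffectι : (crossEffect Y).obj T ⟶ T.obj (op Y) :=
  AddCommGrpCat.ofHom (crossEffectAt Y ⊤ T).subtype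

variable {Y T}

theorem mem_crossEffectAt_top {x : T.obj (op Y)} :
    x ∈ crossEffectAt Y ⊤ T ↔ ∀ U < ⊤, (T.map (familyIdem Y U).op).hom x = 0 := by
  refine ⟨fun h U hU => AddSubgroup.mem_iInf.1 h.1 ⟨U, hU⟩, fun h =>
    ⟨AddSubgroup.mem_iInf.2 fun U => h U.1 U.2, x, ?_⟩⟩
  rw [familyIdem_top, op_id, T.map_id]
  rfl

theorem crossEffectι_map {U : ∀ e, Set (Y e).carrier} (hU : U < ⊤) :
    crossEffectι Y T ≫ T.map (familyIdem Y U).op = 0 := by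
  ext x
  exact mem_crossEffectAt_top.1 x.2 U hU

variable (Y T)

/-- The cross effect `cr_Y(T)` is a direct summand of `T(Y)`, and the subgroup generated by the
images of the `T(d_U)` with `U < Y` is a complement: the projection `ε` vanishes on these images,
and a morphism that vanishes on them and on the cross effect is zero. -/
theorem exists_crossEffect_retraction [Finite E] : ∃ ε : T.obj (op Y) ⟶ (crossEffect Y).obj T,
    crossEffectι Y T ≫ ε = 𝟙 _ ∧
      (∀ U < ⊤, T.map (familyIdem Y U).op ≫ ε = 0) ∧
      ∀ {Z : Ab.{u}} (w : T.obj (op Y) ⟶ Z), crossEffectι Y T ≫ w = 0 →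
        (∀ U < ⊤, T.map (familyIdem Y U).op ≫ w = 0) → w = 0 := by
  have := Fintype.ofFinite {U : ∀ e, Set (Y e).carrier // U < ⊤}
  let d : {U : ∀ e, Set (Y e).carrier // U < ⊤} → AddMonoid.End (T.obj (op Y)) :=
    fun U => (T.map (familyIdem Y U.1).op).hom
  have hd : ∀ U V, d U * d V = (T.map (familyIdem Y (U.1 ⊓ V.1)).op).hom := fun U V => by
    rw [← familyIdem_comp, op_comp, T.map_comp]
    rfl
  obtain ⟨ε, c, h1, h2, h3, h4⟩ := exists_mul_eq_zero_of_commute_idempotent d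
    (fun U V => by rw [Commute, SemiconjBy, hd, hd, inf_comm]) (fun U => by rw [hd, inf_idem])
    Finset.univ
  have h5 : ∀ x, ε x ∈ crossEffectAt Y ⊤ T := fun x => mem_crossEffectAt_top.2 fun U hU =>
    DFunLike.congr_fun (((h2 ⟨U, hU⟩).eq.symm.trans (h1 ⟨U, hU⟩ (Finset.mem_univ _)) :)) x
  have h6 : ∀ x, x = ε x + ∑ U, d U (c U x) := fun x => by
    have h := DFunLike.congr_fun h4 x
    rw [Finset.sum_congr rfl fun U _ => (h3 U U).eq] at h
    rw [← sub_eq_iff_eq_add']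
    exact h.trans (AddMonoidHom.finsetSum_apply _ _ _)
  refine ⟨AddCommGrpCat.ofHom (AddMonoidHom.codRestrict ε _ h5), ?_, fun U hU => ?_,
    fun w hw hw' => ?_⟩
  · ext x
    refine Subtype.ext ?_
    have h := DFunLike.congr_fun h4 x.1
    refine (sub_eq_zero.1 (h.trans ?_)).symm
    refine (AddMonoidHom.finsetSum_apply _ _ _).trans (Finset.sum_eq_zero fun U _ => ?_)
    exact (congrArg (c U) (mem_crossEffectAt_top.1 x.2 U.1 U.2)).trans (map_zero _)
  · ext x
    refine Subtype.ext ?_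
    exact DFunLike.congr_fun (h1 ⟨U, hU⟩ (Finset.mem_univ _)) x
  · ext x
    rw [h6 x, map_add, map_sum]
    have h7 : w.hom (ε x) = 0 := ConcreteCategory.congr_hom hw ⟨ε x, h5 x⟩
    have h8 : ∀ U, w.hom (d U (c U x)) = 0 := fun U =>
      ConcreteCategory.congr_hom (hw' U.1 U.2) (c U x)
    exact (congrArg₂ _ h7 (Finset.sum_eq_zero fun U _ => h8 U)).trans (add_zero 0)

end CrossEffectProjection

/-! ### The colimit as a sum of cross effects -/

section ZerothHomology

open PlantedTree

variable (E : Type u) [Finite E]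

instance : Finite (PlantedTree E) :=
  Finite.of_injective mutes fun _ _ => PlantedTree.ext

/-- The natural map from the cross effect `cr_{F_E(B)}(T)` to the colimit of `T ∘ F_E`. -/
noncomputable def crossEffectToColim {E : Type u} [Finite E]
    (T : (E → FinPartialFun.{u})ᵒᵖ ⥤ Ab.{u}) (B : PlantedTree E) :
    (crossEffect ((branchFunctor E).obj B).unop).obj T ⟶ colimit (branchFunctor E ⋙ T) :=
  crossEffectι B.branches T ≫ colimit.ι (branchFunctor E ⋙ T) B

/-- The natural map from the direct sum of the cross effects `cr_{F_E(B)}(T)`, for `B` in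
`bivalentTrees E`, to the colimit of `T ∘ F_E`. -/
noncomputable def sumCrossEffectToColim :
    (∐ fun B : ↥(bivalentTrees E) => crossEffect ((branchFunctor E).obj B.1).unop) ⟶
      (Functor.whiskeringLeft (PlantedTree E) (E → FinPartialFun.{u})ᵒᵖ Ab.{u}).obj
        (branchFunctor E) ⋙ colim :=
  Limits.Sigma.desc fun B =>
    { app := fun T => crossEffectToColim T B.1
      naturality := fun T T' η => by
        change _ = (_ ≫ _) ≫ colimMap (Functor.whiskerLeft (branchFunctor E) η)
        rw [crossEffectToColim, Category.assoc, ι_colimMap, ← Category.assoc, ← Category.assoc]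
        rfl }

variable {E} (T : (E → FinPartialFun.{u})ᵒᵖ ⥤ Ab.{u})

theorem ι_sumCrossEffectToColim_app (B : ↥(bivalentTrees E)) :
    (Limits.Sigma.ι (fun B : ↥(bivalentTrees E) => crossEffect ((branchFunctor E).obj B.1).unop)
      B).app T ≫ (sumCrossEffectToColim E).app T =
        crossEffectToColim T B.1 := by
  rw [← NatTrans.comp_app, sumCrossEffectToColim, Limits.Sigma.ι_desc]

/-- A morphism from the colimit of `T ∘ F_E` vanishes if it vanishes on the cross effects. -/
theorem eq_zero_of_crossEffectι_comp_eq_zero {Z : Ab.{u}} (w : colimit (branchFunctor E ⋙ T) ⟶ Z)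
    (hw : ∀ B ∈ bivalentTrees E, crossEffectToColim T B ≫ w = 0) : w = 0 := by
  have key : ∀ n, ∀ A : PlantedTree E, A.ancCard = n →
      colimit.ι (branchFunctor E ⋙ T) A ≫ w = 0 := by
    intro n
    induction n using Nat.strong_induction_on with
    | _ n ih =>
      have h : ∀ A ∈ bivalentTrees E, A.ancCard = n →
          colimit.ι (branchFunctor E ⋙ T) A ≫ w = 0 := by
        rintro A hA rfl
        obtain ⟨-, -, -, h⟩ := exists_crossEffect_retraction A.branches T
        refine h (colimit.ι (branchFunctor E ⋙ T) A ≫ w)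
          ((Category.assoc _ _ _).symm.trans (hw A hA)) fun U hU => ?_
        rw [← mapBranches_foldCompl_comp A U, op_comp, T.map_comp, Category.assoc]
        have h2 : T.map (mapBranches (A.foldCompl_le U)).op ≫
            colimit.ι (branchFunctor E ⋙ T) A = colimit.ι (branchFunctor E ⋙ T) (A.foldCompl U) :=
          colimit.w (branchFunctor E ⋙ T) (homOfLE (A.foldCompl_le U))
        rw [reassoc_of% h2, ih _ (ancCard_foldCompl_lt hU) _ rfl, comp_zero]
      intro A hA
      rw [← colimit.w _ (homOfLE A.le_unfold), Category.assoc,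
        h _ A.unfold_mem_bivalentTrees (A.ancCard_unfold.trans hA), comp_zero]
  exact colimit.hom_ext fun A => (key _ A rfl).trans comp_zero.symm

/-- The map from the colimit of `T ∘ F_E` to `T` of the constant family `E`, induced by the
`toBranches`. -/
noncomputable def colimToLabels :
    colimit (branchFunctor E ⋙ T) ⟶ T.obj (op (labels E)) :=
  colimit.desc (branchFunctor E ⋙ T)
    { pt := T.obj (op (labels E))
      ι :=
        { app := fun A => T.map A.toBranches.op
          naturality := fun A A' h => by
            refine Eq.trans ?_ (Category.comp_id _).symm
            rw [← toBranches_mapBranches (leOfHom h), op_comp, T.map_comp]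
            rfl } }

theorem ι_colimToLabels (A : PlantedTree E) :
    colimit.ι (branchFunctor E ⋙ T) A ≫ colimToLabels T = T.map A.toBranches.op :=
  colimit.ι_desc _ _

/-- The maps between cross effects induced by the comparison of the branches of two different trees
of `bivalentTrees E` vanish. -/
theorem crossEffectι_ofBranches_toBranches_of_ne {B B' : PlantedTree E} (hB : B ∈ bivalentTrees E)
    (hB' : B' ∈ bivalentTrees E) (hne : B ≠ B') {Z : Ab.{u}} (ε : T.obj (op B'.branches) ⟶ Z)
    (hε : ∀ U < ⊤, T.map (familyIdem B'.branches U).op ≫ ε = 0) :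
    crossEffectι B.branches T ≫ T.map (B'.ofBranches ≫ B.toBranches).op ≫ ε = 0 := by
  by_cases htot : ∀ e (c : B'.Branch e), (((B'.ofBranches ≫ B.toBranches) e).toPFun c).Dom
  · have hsurj : ¬ ∀ e (d : B.Branch e), ∃ c : B'.Branch e,
        d ∈ ((B'.ofBranches ≫ B.toBranches) e).toPFun c := fun hsurj =>
      hne (eq_of_ofBranches_toBranches_surjective hB hB' htot hsurj)
    rw [← comp_familyIdem_range (B'.ofBranches ≫ B.toBranches), op_comp, T.map_comp,
      Category.assoc, ← Category.assoc, crossEffectι_map, zero_comp]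
    refine lt_top_iff_ne_top.2 fun h => hsurj fun e d => ?_
    exact Set.eq_univ_iff_forall.1 (congrFun h e) d
  · rw [← familyIdem_dom_comp (B'.ofBranches ≫ B.toBranches), op_comp, T.map_comp,
      Category.assoc, hε, comp_zero, comp_zero]
    refine lt_top_iff_ne_top.2 fun h => htot fun e c => ?_
    exact Set.eq_univ_iff_forall.1 (congrFun h e) c

/-- The map from the sum of the cross effects to the colimit has a left inverse that factors through
`colimToLabels`. -/
theorem exists_retraction_colimToLabels :
    ∃ ρ : T.obj (op (labels E)) ⟶ (∐ fun B : ↥(bivalentTrees E) =>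
        crossEffect ((branchFunctor E).obj B.1).unop).obj T,
      (sumCrossEffectToColim E).app T ≫ colimToLabels T ≫ ρ = 𝟙 _ := by
  classical
  have := Fintype.ofFinite ↥(bivalentTrees E)
  choose ε h1 h2 _ using fun B : ↥(bivalentTrees E) => exists_crossEffect_retraction B.1.branches T
  refine ⟨∑ B, T.map B.1.ofBranches.op ≫ ε B ≫ (Limits.Sigma.ι (fun B : ↥(bivalentTrees E) =>
    crossEffect ((branchFunctor E).obj B.1).unop) B).app T, ?_⟩
  refine (isColimitOfPreserves ((evaluation _ _).obj T) (colimit.isColimit (Discrete.functor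
    fun B : ↥(bivalentTrees E) => crossEffect ((branchFunctor E).obj B.1).unop))).hom_ext ?_
  rintro ⟨B⟩
  change (Limits.Sigma.ι (fun B : ↥(bivalentTrees E) =>
    crossEffect ((branchFunctor E).obj B.1).unop) B).app T ≫ _ = (Limits.Sigma.ι (fun B :
    ↥(bivalentTrees E) => crossEffect ((branchFunctor E).obj B.1).unop) B).app T ≫ 𝟙 _
  rw [← Category.assoc, ι_sumCrossEffectToColim_app, crossEffectToColim, Category.assoc,
    reassoc_of% (ι_colimToLabels T B.1), Preadditive.comp_sum, Preadditive.comp_sum,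
    Finset.sum_eq_single B, Category.comp_id]
  · rw [← T.map_comp_assoc, ← op_comp, ofBranches_toBranches, op_id, T.map_id, Category.id_comp,
      reassoc_of% (h1 B)]
  · intro B' _ hne
    rw [← T.map_comp_assoc, ← op_comp]
    have := crossEffectι_ofBranches_toBranches_of_ne T B.2 B'.2
      (fun h => hne (Subtype.ext h.symm)) (ε B') (h2 B')
    rw [reassoc_of% this, zero_comp]
  · exact fun h => absurd (Finset.mem_univ _) h

instance isIso_sumCrossEffectToColim_app : IsIso ((sumCrossEffectToColim E).app T) := by
  obtain ⟨ρ, hρ⟩ := exists_retraction_colimToLabels T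
  have : Mono ((sumCrossEffectToColim E).app T) := mono_of_mono_fac hρ
  have : Epi ((sumCrossEffectToColim E).app T) := by
    refine Preadditive.epi_of_cancel_zero _ fun {Z} w hw => ?_
    refine eq_zero_of_crossEffectι_comp_eq_zero T w fun B hB => ?_
    rw [← ι_sumCrossEffectToColim_app T ⟨B, hB⟩, Category.assoc, hw, comp_zero]
  exact isIso_of_mono_of_epi _

instance isIso_sumCrossEffectToColim : IsIso (sumCrossEffectToColim E) :=
  NatIso.isIso_of_isIso_app _

/-- As the sum of the cross effects is the whole colimit, its left inverse, which factors through
`colimToLabels`, is an isomorphism. -/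
instance mono_colimToLabels : Mono (colimToLabels T) := by
  obtain ⟨ρ, hρ⟩ := exists_retraction_colimToLabels T
  have h : colimToLabels T ≫ ρ = inv ((sumCrossEffectToColim E).app T) :=
    (IsIso.eq_inv_of_hom_inv_id hρ)
  have : Mono (colimToLabels T ≫ ρ) := h ▸ inferInstance
  exact mono_of_mono (colimToLabels T) ρ

/-- The functor `T ↦ colim (T ∘ F_E)` preserves monomorphisms. -/
theorem mono_colim_map_whiskerLeft {K P : (E → FinPartialFun.{u})ᵒᵖ ⥤ Ab.{u}} (i : K ⟶ P) [Mono i] :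
    Mono ((colim : (PlantedTree E ⥤ Ab.{u}) ⥤ Ab.{u}).map
      (Functor.whiskerLeft (branchFunctor E) i)) := by
  have h : colimMap (Functor.whiskerLeft (branchFunctor E) i) ≫ colimToLabels P =
      colimToLabels K ≫ i.app _ := by
    refine colimit.hom_ext fun A => ?_
    rw [ι_colimMap_assoc, ι_colimToLabels, reassoc_of% (ι_colimToLabels K A)]
    exact (i.naturality _).symm
  exact @mono_of_mono_fac _ _ _ _ _ _ _ _ (mono_comp _ _) h

end ZerothHomology

/-! ### Vanishing in positive degrees -/

section Contraction

variable {J : Type u} [PartialOrder J] {S : Set J}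

/-- The functor with constant value `M` on the upper set `S` that vanishes outside `S`. Its value at
`a` is written as a subgroup of `M`, which is `M` or `0`. -/
def constOn (hS : IsUpperSet S) (M : Type u) [AddCommGroup M] : J ⥤ Ab.{u} where
  obj a := AddCommGrpCat.of (⨅ _ : a ∉ S, ⊥ : AddSubgroup M)
  map h := AddCommGrpCat.ofHom (AddSubgroup.inclusion
    (le_iInf fun ha => iInf_le_of_le (fun h' => ha (hS (leOfHom h) h')) le_rfl))
  map_id _ := rfl
  map_comp _ _ := rfl

variable {hS : IsUpperSet S} {M : Type u} [AddCommGroup M] {r : J → J} {b : J}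

/-- A constant functor on a conically contractible upper set is adapted. -/
theorem adapted_constOn (h : ConicalContraction S r b) : h.Adapted (constOn h.isUpperSet M) where
  isZero a ha := by
    have h0 : (⨅ _ : a ∉ S, ⊥ : AddSubgroup M) = ⊥ := iInf_pos ha
    refine @AddCommGrpCat.isZero_of_subsingleton _ ?_
    change Subsingleton ↥(⨅ _ : a ∉ S, ⊥ : AddSubgroup M)
    rw [h0]
    infer_instance
  isIso a ha := by
    rw [ConcreteCategory.isIso_iff_bijective]
    have h0 : (⨅ _ : r a ∉ S, ⊥ : AddSubgroup M) = ⊤ := iInf_neg (not_not.2 (h.mem ha))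
    exact ⟨fun x y hxy => Subtype.ext
      (congrArg (Subtype.val : ↥(⨅ _ : a ∉ S, ⊥ : AddSubgroup M) → M) hxy),
      fun x => ⟨⟨x.1, h0 ▸ AddSubgroup.mem_top _⟩, rfl⟩⟩

end Contraction

section Vanishing

open PlantedTree Nesting

variable {E : Type u} [Finite E] {Y : E → FinPartialFun.{u}}

/-- The trees `A` such that `g` factors through `A.toBranches`. -/
def factorSet (g : labels E ⟶ Y) : Set (PlantedTree E) :=
  {A | A.toBranches ≫ A.ofBranches ≫ g = g}

/-- Any factorization of `g` through `A.toBranches` gives the condition that defines `factorSet g`,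
because `A.ofBranches` is a section of `A.toBranches`. -/
theorem mem_factorSet_of_eq_comp {g : labels E ⟶ Y} {A : PlantedTree E} (g' : A.branches ⟶ Y)
    (h : g = A.toBranches ≫ g') : A ∈ factorSet g := by
  change _ ≫ _ ≫ _ = _
  rw [h, reassoc_of% A.ofBranches_toBranches]

theorem isUpperSet_factorSet (g : labels E ⟶ Y) : IsUpperSet (factorSet g) := by
  intro A A' h (hA : _ ≫ _ ≫ _ = _)
  rw [← toBranches_mapBranches h, Category.assoc] at hA
  exact mem_factorSet_of_eq_comp _ hA.symm

/-- The tree obtained from `A` by folding the branches on which `g` is not defined. -/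
def foldAt (g : labels E ⟶ Y) (A : PlantedTree E) : PlantedTree E :=
  A.fold fun e v => ((g e).toPFun v).Dom

variable {g : labels E ⟶ Y} {A A' : PlantedTree E} {e v w : E}

theorem foldAt_anc (h : A ∈ factorSet g) :
    (foldAt g A).nesting.Anc e v ↔ ((g e).toPFun v).Dom := by
  obtain ⟨h1, h2⟩ := toBranches_ofBranches_comp_eq_iff.1 h
  exact fold_rel.trans (restrict_anc (fun e v w hvw hv => h2 e v w hvw ▸ hv) h1)

theorem foldAt_rel (h : A ∈ factorSet g) :
    (foldAt g A).nesting.rel e v w ↔ A.nesting.rel e v w ∧ ((g e).toPFun v).Dom := by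
  rw [← foldAt_anc h, foldAt, fold_rel, restrict_rel]
  exact and_congr_right fun _ => fold_rel.symm

theorem foldAt_mem (h : A ∈ factorSet g) : foldAt g A ∈ factorSet g :=
  toBranches_ofBranches_comp_eq_iff.2 ⟨fun _ _ => (foldAt_anc h).2, fun e v w hvw =>
    (toBranches_ofBranches_comp_eq_iff.1 h).2 e v w ((foldAt_rel h).1 hvw).1⟩

theorem foldAt_mono (hA : A ∈ factorSet g) (h : A ≤ A') : foldAt g A ≤ foldAt g A' := by
  have hA' := isUpperSet_factorSet g h hA
  refine le_iff_nesting.2 ⟨fun e v hv => (foldAt_anc hA').2 ((foldAt_anc hA).1 hv),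
    fun e v w hvw hv => ?_⟩
  have hv' := (foldAt_anc hA).1 hv
  exact (foldAt_rel hA).2 ⟨(le_iff_nesting.1 h).2 e v w ((foldAt_rel hA').1 hvw).1
    ((toBranches_ofBranches_comp_eq_iff.1 hA).1 e v hv'), hv'⟩

/-- The trees `foldAt g A` all have the same ancestors, so that they lie below the common tree
obtained by unfolding any of them. -/
theorem conicalContraction_factorSet (h : A ∈ factorSet g) :
    ConicalContraction (factorSet g) (foldAt g) (foldAt g A).unfold where
  isUpperSet := isUpperSet_factorSet g
  mem := foldAt_mem
  le _ := fold_le _ _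
  mono := foldAt_mono
  idem hA := eq_of_nesting_rel_iff fun e v w => by
    rw [foldAt_rel (foldAt_mem hA), foldAt_rel hA, and_assoc, and_self]
  base_mem := isUpperSet_factorSet g (le_unfold _) (foldAt_mem h)
  le_base {A'} hA' := by
    have hanc : ∀ {e v}, (foldAt g A).nesting.Anc e v ↔ (foldAt g A').nesting.Anc e v :=
      (foldAt_anc h).trans (foldAt_anc hA').symm
    refine le_iff_nesting.2 ⟨fun e v hv => unfold_anc.2 (hanc.2 hv), fun e v w hvw _ => ?_⟩
    obtain ⟨x, hx, hv, hw⟩ := unfold_rel.1 hvw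
    exact rel_of_split_rel ⟨x, hanc.1 hx, hv.imp id hanc.1, hw.imp id hanc.1⟩

theorem extAcyclic_constOn (g : labels E ⟶ Y) (M : Type u) [AddCommGroup M] :
    ExtAcyclic.{u} (Functor.const (PlantedTree E)) (constOn (isUpperSet_factorSet g) M) := by
  by_cases h : (factorSet g).Nonempty
  · obtain ⟨A, hA⟩ := h
    exact (adapted_constOn (conicalContraction_factorSet hA)).extAcyclic _
  · have : Projective (constOn (isUpperSet_factorSet g) M) := by
      refine @Projective.of_iso _ _ _ _ (IsZero.iso (isZero_zero _) ?_) inferInstance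
      refine Functor.isZero _ fun A => ?_
      have h0 : (⨅ _ : A ∉ factorSet g, ⊥ : AddSubgroup M) = ⊥ := iInf_pos fun hA => h ⟨A, hA⟩
      refine @AddCommGrpCat.isZero_of_subsingleton _ ?_
      change Subsingleton ↥(⨅ _ : A ∉ factorSet g, ⊥ : AddSubgroup M)
      rw [h0]
      infer_instance
    exact extAcyclic_of_projective _ _

/-- The pairs formed by a tree `A` and a morphism from `Y` to `F_E(A)`. -/
abbrev MapsToBranches (Y : E → FinPartialFun.{u}) : Type u :=
  Σ A : PlantedTree E, Y ⟶ A.branches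

variable (E) in
/-- The functor `Y ↦ ⨁ M` on `Γ^E`, where the sum is over all the trees `A` and all the morphisms
from `Y` to `F_E(A)`: a direct sum of representable functors tensored with `M`. -/
noncomputable def freeOnBranches (M : Type u) [AddCommGroup M] :
    (E → FinPartialFun.{u})ᵒᵖ ⥤ Ab.{u} where
  obj Y := AddCommGrpCat.of (MapsToBranches Y.unop →₀ M)
  map h := AddCommGrpCat.ofHom (Finsupp.mapDomain.addMonoidHom fun s => ⟨s.1, h.unop ≫ s.2⟩)
  map_id Y := by
    ext s x : 3
    simp
  map_comp h h' := by
    ext s x : 3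
    simp

theorem freeOnBranches_map_single (M : Type u) [AddCommGroup M] {Y Z : E → FinPartialFun.{u}}
    (f : Z ⟶ Y) (s : MapsToBranches Y) (x : M) :
    ((freeOnBranches E M).map f.op).hom (Finsupp.single s x) =
      Finsupp.single (⟨s.1, f ≫ s.2⟩ : MapsToBranches Z) x :=
  Finsupp.mapDomain_single

instance : Finite (MapsToBranches (labels E)) := by
  have : ∀ A : PlantedTree E, Finite (labels E ⟶ A.branches) := fun A =>
    Finite.of_injective (β := ∀ e, Set (E × A.Branch e))
      (fun f e => {p | p.2 ∈ (f e).toPFun p.1}) fun f f' h =>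
        FinPartialFun.hom_ext fun e x y => Set.ext_iff.1 (congrFun h e) (x, y)
  infer_instance

section

variable (M : Type u) [AddCommGroup M] (s : MapsToBranches (labels E))

/-- The coefficient of `s` in the image in `freeOnBranches E M` of the constant family `E`. -/
noncomputable def coeffAt : branchFunctor E ⋙ freeOnBranches E M ⟶
    constOn (isUpperSet_factorSet s.2) M where
  app A := AddCommGrpCat.ofHom (((Finsupp.applyAddHom s).comp
    ((freeOnBranches E M).map A.toBranches.op).hom).codRestrict
      (⨅ _ : A ∉ factorSet s.2, ⊥ : AddSubgroup M) fun q => AddSubgroup.mem_iInf.2 fun hA =>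
        Finsupp.mapDomain_of_notMem_range _ _ fun ⟨t, ht⟩ => hA (by
          subst ht
          exact mem_factorSet_of_eq_comp _ rfl))
  naturality A A' h := by
    ext q
    refine Subtype.ext ?_
    have h1 : ((freeOnBranches E M).map A'.toBranches.op).hom
      (((freeOnBranches E M).map (mapBranches (leOfHom h)).op).hom q) =
        ((freeOnBranches E M).map A.toBranches.op).hom q := by
      rw [← toBranches_mapBranches (leOfHom h), op_comp, Functor.map_comp]
      rfl
    exact DFunLike.congr_fun (F := MapsToBranches (labels E) →₀ M) h1 s

/-- The map that sends `x` to `x` times the element of the basis given by a factorization of `s`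
through the branches. -/
noncomputable def singleAt : constOn (isUpperSet_factorSet s.2) M ⟶
    branchFunctor E ⋙ freeOnBranches E M where
  app A := AddCommGrpCat.ofHom ((Finsupp.singleAddHom
    (⟨s.1, A.ofBranches ≫ s.2⟩ : MapsToBranches A.branches)).comp
      (⨅ _ : A ∉ factorSet s.2, ⊥ : AddSubgroup M).subtype)
  naturality A A' h := by
    ext x
    change Finsupp.single (⟨s.1, A'.ofBranches ≫ s.2⟩ : MapsToBranches A'.branches) x.1 =
      ((freeOnBranches E M).map (mapBranches (leOfHom h)).op).hom
        (Finsupp.single (⟨s.1, A.ofBranches ≫ s.2⟩ : MapsToBranches A.branches) x.1)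
    rw [freeOnBranches_map_single]
    by_cases hA : A ∈ factorSet s.2
    · have hA : A.toBranches ≫ A.ofBranches ≫ s.2 = s.2 := hA
      rw [← toBranches_mapBranches (leOfHom h), Category.assoc] at hA
      nth_rewrite 1 [← hA]
      rw [reassoc_of% A'.ofBranches_toBranches]
    · have hx : x.1 = 0 := AddSubgroup.mem_iInf.1 x.2 hA
      rw [hx, Finsupp.single_zero, Finsupp.single_zero]

open Classical in
/-- The composite of `coeffAt M s` and `singleAt M s` is the projection onto the span of the
elements of the basis which `A.toBranches` maps to `s`. -/
theorem coeffAt_singleAt_single (A : PlantedTree E) (t : MapsToBranches A.branches) (x : M) :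
    ((coeffAt M s ≫ singleAt M s).app A).hom (Finsupp.single t x) =
      if s = (⟨t.1, A.toBranches ≫ t.2⟩ : MapsToBranches (labels E))
        then Finsupp.single t x else 0 := by
  change Finsupp.single (⟨s.1, A.ofBranches ≫ s.2⟩ : MapsToBranches A.branches)
    ((Finsupp.mapDomain (fun t => ⟨t.1, A.toBranches ≫ t.2⟩) (Finsupp.single t x) :
      MapsToBranches (labels E) →₀ M) s) = _
  rw [Finsupp.mapDomain_single, Finsupp.single_apply]
  by_cases h : s = (⟨t.1, A.toBranches ≫ t.2⟩ : MapsToBranches (labels E))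
  · subst h
    rw [if_pos rfl, if_pos rfl, reassoc_of% A.ofBranches_toBranches]
  · rw [if_neg h, if_neg (Ne.symm h), Finsupp.single_zero]

end

/-- Any element of the basis of `T(F_E(A))`, for `T = freeOnBranches E M`, is mapped by
`A.toBranches` to exactly one `s`, so that the identity is the sum over `s` of the projections
`coeffAt` followed by `singleAt`. -/
theorem extAcyclic_freeOnBranches (M : Type u) [AddCommGroup M] :
    ExtAcyclic.{u} (Functor.const (PlantedTree E)) (branchFunctor E ⋙ freeOnBranches E M) := by
  classical
  have := Fintype.ofFinite (MapsToBranches (labels E))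
  refine extAcyclic_of_sum_eq_id (coeffAt M) (singleAt M) ?_
    fun s => extAcyclic_constOn s.2 M
  refine NatTrans.ext (funext fun A => ?_)
  refine AddCommGrpCat.hom_ext (Finsupp.addHom_ext fun t x => ?_)
  rw [NatTrans.app_sum]
  refine (DFunLike.congr_fun (map_sum AddCommGrpCat.homAddEquiv _ _) _).trans ?_
  refine (AddMonoidHom.finsetSum_apply _ _ _).trans ?_
  refine (Finset.sum_congr rfl fun s _ => coeffAt_singleAt_single M s A t x).trans ?_
  exact (Finset.sum_ite_eq' (M := MapsToBranches A.branches →₀ M) _ _ _).trans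
    (if_pos (Finset.mem_univ _))

/-- The natural map to `T` from a functor that is free on branches. -/
noncomputable def freeOnBranchesDesc (T : (E → FinPartialFun.{u})ᵒᵖ ⥤ Ab.{u}) :
    freeOnBranches E (∀ A : PlantedTree E, T.obj (op A.branches)) ⟶ T where
  app Y := AddCommGrpCat.ofHom (Finsupp.liftAddHom fun s =>
    (T.map s.2.op).hom.comp (Pi.evalAddMonoidHom _ s.1))
  naturality Y Z h := by
    refine AddCommGrpCat.hom_ext (Finsupp.addHom_ext fun s x => ?_)
    change Finsupp.liftAddHom _ (Finsupp.mapDomain _ _) = (T.map h).hom (Finsupp.liftAddHom _ _)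
    rw [Finsupp.mapDomain_single, Finsupp.liftAddHom_apply_single, Finsupp.liftAddHom_apply_single]
    change (T.map (s.2.op ≫ h)).hom _ = _
    rw [T.map_comp]
    rfl

/-- The components at the `F_E(A)` are surjective: use the identity of `F_E(A)`. The other
components need not be. -/
instance epi_whiskerLeft_freeOnBranchesDesc (T : (E → FinPartialFun.{u})ᵒᵖ ⥤ Ab.{u}) :
    Epi (Functor.whiskerLeft (branchFunctor E) (freeOnBranchesDesc T)) := by
  rw [NatTrans.epi_iff_epi_app]
  refine fun A => (AddCommGrpCat.epi_iff_surjective _).2 fun x => ?_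
  classical
  refine ⟨Finsupp.single (⟨A, 𝟙 _⟩ : MapsToBranches A.branches) (Pi.single A x), ?_⟩
  refine (Finsupp.liftAddHom_apply_single _ _ _).trans ?_
  change (T.map (𝟙 _)).hom ((Pi.single A x : ∀ A : PlantedTree E, T.obj (op A.branches)) A) = x
  rw [Pi.single_eq_same, T.map_id]
  rfl

/-- The functors `T ∘ F_E` are acyclic, by dimension shifting in the family of all of them. -/
theorem extAcyclic_branchFunctor_comp (T : (E → FinPartialFun.{u})ᵒᵖ ⥤ Ab.{u}) :
    ExtAcyclic.{u} (Functor.const (PlantedTree E)) (branchFunctor E ⋙ T) := by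
  refine extAcyclic_of_family (L := colim) colimConstAdj
    (fun T : (E → FinPartialFun.{u})ᵒᵖ ⥤ Ab.{u} => branchFunctor E ⋙ T) (fun T => ?_) T
  let p := freeOnBranchesDesc T
  let W := (Functor.whiskeringLeft (PlantedTree E) (E → FinPartialFun.{u})ᵒᵖ Ab.{u}).obj
    (branchFunctor E)
  refine ⟨kernel p, _, W.map (kernel.ι p), W.map p, ?_, ?_, extAcyclic_freeOnBranches _,
    mono_colim_map_whiskerLeft _⟩
  · rw [← W.map_comp, kernel.condition, W.map_zero]
  · have : Mono (W.map (kernel.ι p)) := inferInstance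
    have : Epi (W.map p) := epi_whiskerLeft_freeOnBranchesDesc T
    exact { exact := (ShortComplex.exact_kernel p).map W }

end Vanishing

theorem mainTheorem6 (E : Type u) [Finite E] :
    Nonempty
      ((Functor.whiskeringLeft (PlantedTree E) (E → FinPartialFun.{u})ᵒᵖ Ab.{u}).obj
          (branchFunctor E) ⋙ categoryHomology (PlantedTree E) 0 ≅
        ∐ fun A : ↥(PlantedTree.bivalentTrees E) =>
          crossEffect ((branchFunctor E).obj A.1).unop) ∧
    ∀ (T : (E → FinPartialFun.{u})ᵒᵖ ⥤ Ab.{u}) (n : ℕ), 0 < n →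
      IsZero ((categoryHomology (PlantedTree E) n).obj (branchFunctor E ⋙ T)) := by
  refine ⟨⟨?_⟩, fun T n hn => ?_⟩
  · have := (colimConstAdj (J := PlantedTree E) (C := Ab.{u})).isLeftAdjoint
    exact Functor.isoWhiskerLeft _ (Functor.leftDerivedZeroIsoSelf _) ≪≫
      (asIso (sumCrossEffectToColim E)).symm
  · obtain ⟨n, rfl⟩ := Nat.exists_eq_succ_of_ne_zero hn.ne'
    exact isZero_leftDerived_of_extAcyclic colimConstAdj (extAcyclic_branchFunctor_comp T) n
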